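/- Consider $n\ge 1$ nodes with identifiers $1,\dots,n$, known to all nodes, which form a fully connected synchronous network: in each round every node performs arbitrary local computations, sends a (possibly different) message to every node, itself included, and receives the messages sent to it. Write $\ell(n)=\lfloor\log_2 n\rfloor+1$. There is an absolute constant $R$ such that for every $c\in\mathbb{N}$ there is a constant $C\in\mathbb{N}$, depending only on $c$, with the following property. Let $n\ge 1$, let $K$ be a totally ordered set of keys that are encoded injectively by bit strings of length $c\cdot\ell(n)$ (the order and the encoding are known to all nodes), and let each node be given as input a list of at most $n$ keys from $K$, where keys may be repeated within a node and between nodes. Then each of the following tasks can be solved by a deterministic algorithm in $R$ rounds with messages of $C\cdot\ell(n)$ bits: 1. (Indices.) Each node learns, for each of its input keys, the index of this key in the sorted sequence of the distinct keys that occur in the inputs of all nodes; in particular, copies of the same key have the same index. 2. (Selection.) For any given $k\ge 1$ known to all nodes, every node learns the $k$-th key in the sorted sequence of all input keys with repetitions, and likewise the $k$-th key in the sorted sequence of the distinct input keys, or learns that the sequence has fewer than $k$ elements. 3. (Mode.) All nodes learn a common mode, i.e. a key that occurs a maximum number of times among all input keys, or learn that there are no input keys. -/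

import Mathlib

namespace CongestedClique

/-- A message of `B` bits. -/
abbrev Message (B : ℕ) : Type := Fin B → Bool

/-- A deterministic algorithm for the fully connected synchronous system with node set `Fin n`, in
which every ordered pair of nodes (a node and itself included) exchanges `B` bits per round. The
local computations `init`, `send`, `receive`, `output` of node `i` are arbitrary functions of what
node `i` knows: `n`, its identifier, the number of the current round, its own input, and the
messages it has received (the latter two through its local state). -/
structure Protocol (n B : ℕ) (In Out : Type) where
  /-- The local states of the nodes. -/
  State : Type
  /-- The state of node `i` at the start, computed from its own input. -/
  init : Fin n → In → State
  /-- `send r i s j` is the message from node `i`, in state `s`, to node `j` in round `r`. -/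
  send : ℕ → Fin n → State → Fin n → Message B
  /-- `receive r i s m` is the state of node `i` after round `r`, when it was in state `s` and `m j`
  is the message that it received from node `j`. -/
  receive : ℕ → Fin n → State → (Fin n → Message B) → State
  /-- The output of node `i`, computed from its state. -/
  output : Fin n → State → Out

/-- The state of every node after a number of rounds on input `x`. -/
def Protocol.state {n B : ℕ} {In Out : Type} (P : Protocol n B In Out) (x : Fin n → In) :
    ℕ → Fin n → P.State
  | 0 => fun i => P.init i (x i)
  | r + 1 => fun i =>
      P.receive r i (P.state x r i) (fun j => P.send r j (P.state x r j) i)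

/-- The outputs of the nodes after `R` rounds on input `x`. -/
def Protocol.run {n B : ℕ} {In Out : Type} (P : Protocol n B In Out) (R : ℕ) (x : Fin n → In) :
    Fin n → Out :=
  fun i => P.output i (P.state x R i)

/-- A task (a relation between the inputs and the outputs of the `n` nodes) is solvable
deterministically in `R` rounds with messages of `B` bits. -/
def Solvable {n : ℕ} {In Out : Type} (R B : ℕ)
    (task : (Fin n → In) → (Fin n → Out) → Prop) : Prop :=
  ∃ P : Protocol n B In Out, ∀ x : Fin n → In, task x (P.run R x)

/-- The input of a single node: a list of up to `n` keys, repetitions allowed. -/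
abbrev KeyInput (n : ℕ) (K : Type) : Type := {l : List K // l.length ≤ n}

section Tasks

variable {n : ℕ} {K : Type} [LinearOrder K]

/-- All keys in the system, with multiplicities. -/
def allKeys (x : Fin n → KeyInput n K) : Multiset K := ∑ i, ((x i).1 : Multiset K)

/-- The sorted sequence of all keys in the system, with repetitions. -/
def sortedKeys (x : Fin n → KeyInput n K) : List K := (allKeys x).sort (· ≤ ·)

/-- The sorted sequence of the distinct keys in the system, without repetitions. -/
def sortedDistinctKeys (x : Fin n → KeyInput n K) : List K := (allKeys x).toFinset.sort (· ≤ ·)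

/-- Every node outputs, for each of its input keys (in the order of its input), the index of that
key, counted from `1`, in the sorted sequence of the distinct keys in the system. -/
def IndexTask (x : Fin n → KeyInput n K) (y : Fin n → List ℕ) : Prop :=
  ∀ i, y i = (x i).1.map (fun a => (sortedDistinctKeys x).idxOf a + 1)

/-- Every node outputs the key at position `k`, counted from `0`, of the sorted sequence of all keys
with repetitions (`none` if there is no such position). -/
def SelectionTask (k : ℕ) (x : Fin n → KeyInput n K) (y : Fin n → Option K) : Prop :=
  ∀ i, y i = (sortedKeys x)[k]?

/-- Every node outputs the key at position `k`, counted from `0`, of the sorted sequence of the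
distinct keys (`none` if there is no such position). -/
def DistinctSelectionTask (k : ℕ) (x : Fin n → KeyInput n K) (y : Fin n → Option K) : Prop :=
  ∀ i, y i = (sortedDistinctKeys x)[k]?

/-- `a` is a mode: a key in the system of maximum multiplicity. -/
def IsMode (x : Fin n → KeyInput n K) (a : K) : Prop :=
  a ∈ allKeys x ∧ ∀ b, (allKeys x).count b ≤ (allKeys x).count a

/-- All nodes output the same mode (`none` if there are no keys in the system at all). -/
def ModeTask (x : Fin n → KeyInput n K) (y : Fin n → Option K) : Prop :=
  (allKeys x = 0 → ∀ i, y i = none) ∧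
    (allKeys x ≠ 0 → ∃ a, IsMode x a ∧ ∀ i, y i = some a)

end Tasks

end CongestedClique

namespace CongestedClique

/-! ### Encodings by bit strings -/

/-! The inputs form one array of n² entries, row i at node i, with short lists padded by ⊤.
Everything reduces to sorting this array in constantly many rounds with O(1) entries per message.

If every node holds O(n) entries before and after a move, a greedy edge colouring of the multigraph
of sources and targets uses O(n) colours. Colours mod n serve as relay nodes, so each of two rounds
carries O(1) entries between any two nodes (`hostedSolvable_rehost`). Hence classes that fit at
single nodes can be gathered, sorted locally and sent back.

Column sort handles larger classes: for s windows of length m ≥ 2s² with s ∣ m, sort the windows,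
the residue classes mod s, the windows, and the windows shifted by m/2. By the 0–1 principle it is
enough to follow, for each threshold t, the set of ranks whose entries are at most t
(`natClassSort_columnSort`, transferred by `profile_classSort_refine`). Two nested levels with s
about √n reach n² entries with leaf classes of size O(n) (`hostedSolvable_sort`).

Keys are sorted tagged with their positions. In the sorted array a value shared by two rows is the
last of the earlier and the first of the later row, so broadcasting a short summary of each row
yields all ranks (`rowEntry_eq`); a second sort, by origin, returns them (`solvable_entries`). The
numbers of keys below b, of keys up to b and of distinct keys up to b decide index, selection and
multiplicity. One more broadcast makes all nodes agree on a best key (`solvable_bestKey`). -/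

/-- The elements of `τ` can be encoded by `B` bits. -/
def Fits (B : ℕ) (τ : Type) : Prop := Nonempty (τ ↪ Message B)

theorem fits_iff_card {B : ℕ} {τ : Type} [Fintype τ] : Fits B τ ↔ Fintype.card τ ≤ 2 ^ B := by
  constructor
  · rintro ⟨e⟩
    simpa using Fintype.card_le_of_embedding e
  · intro h
    exact Function.Embedding.nonempty_of_card_le (by simpa using h)

theorem Fits.of_injective {B : ℕ} {τ υ : Type} (h : Fits B υ) (f : τ → υ)
    (hf : Function.Injective f) : Fits B τ :=
  h.map fun e => (⟨f, hf⟩ : τ ↪ υ).trans e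

theorem Fits.mono {A B : ℕ} {τ : Type} (h : Fits A τ) (hAB : A ≤ B) : Fits B τ := by
  have : Fits B (Message A) := fits_iff_card.2 (by
    simpa using Nat.pow_le_pow_right (by norm_num) hAB)
  obtain ⟨e⟩ := h
  exact this.of_injective e e.injective

theorem Fits.prod {A B : ℕ} {τ υ : Type} (h : Fits A τ) (h' : Fits B υ) :
    Fits (A + B) (τ × υ) := by
  obtain ⟨e⟩ := h
  obtain ⟨e'⟩ := h'
  have : Fits (A + B) (Message A × Message B) := fits_iff_card.2 (by simp [pow_add])
  exact this.of_injective (Prod.map e e') (e.injective.prodMap e'.injective)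

theorem Fits.option {B : ℕ} {τ : Type} (h : Fits B τ) : Fits (B + 1) (Option τ) := by
  obtain ⟨e⟩ := h
  have : Fits (B + 1) (Option (Message B)) := fits_iff_card.2 (by
    have := Nat.one_le_two_pow (n := B)
    simp only [Fintype.card_option, Fintype.card_pi, Fintype.card_bool, Finset.prod_const,
      Finset.card_univ, Fintype.card_fin, pow_succ]
    omega)
  exact this.of_injective (Option.map e) (Option.map_injective e.injective)

theorem Fits.pi {B : ℕ} {τ : Type} (h : Fits B τ) (k : ℕ) : Fits (k * B) (Fin k → τ) := by
  obtain ⟨e⟩ := h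
  have : Fits (k * B) (Fin k → Message B) := fits_iff_card.2 (by
    simp [← pow_mul, mul_comm])
  exact this.of_injective (fun f i => e (f i)) fun f g hfg =>
    funext fun i => e.injective (congrFun hfg i)

theorem fits_fin {k B : ℕ} (h : k ≤ 2 ^ B) : Fits B (Fin k) := fits_iff_card.2 (by simpa using h)

/-! ### Composition of algorithms -/

section Compose

variable {n B R R₁ R₂ : ℕ} {α β γ τ : Type}

theorem Solvable.imp {t t' : (Fin n → α) → (Fin n → β) → Prop} (h : Solvable R B t)
    (htt : ∀ x y, t x y → t' x y) : Solvable R B t' :=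
  Exists.imp (fun _ hP x => htt _ _ (hP x)) h

/-- Any local computation takes no rounds, and may be delayed by idle rounds. -/
theorem solvable_local (R B : ℕ) (f : Fin n → α → β) :
    Solvable R B (fun (x : Fin n → α) y => ∀ i, y i = f i (x i)) := by
  let P : Protocol n B α β :=
    { State := α
      init := fun _ x => x
      send := fun _ _ _ _ _ => false
      receive := fun _ _ s _ => s
      output := f }
  refine ⟨P, fun x i => ?_⟩
  have h : ∀ r, P.state x r i = x i := by
    intro r
    induction r with
    | zero => rfl
    | succ r ih => exact ih
  exact congrArg (f i) (h R)

/-- Run `P` for `R₁` rounds and then `Q` on the outputs of `P`. -/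
def Protocol.trans (P : Protocol n B α β) (R₁ : ℕ) (Q : Protocol n B β γ) : Protocol n B α γ where
  State := P.State ⊕ Q.State
  init i x := .inl (P.init i x)
  send r i s j :=
    if r < R₁ then s.elim (fun p => P.send r i p j) (fun _ _ => false)
    else Q.send (r - R₁) i (s.elim (fun p => Q.init i (P.output i p)) id) j
  receive r i s m :=
    if r < R₁ then s.elim (fun p => .inl (P.receive r i p m)) .inr
    else .inr (Q.receive (r - R₁) i (s.elim (fun p => Q.init i (P.output i p)) id) m)
  output i s := Q.output i (s.elim (fun p => Q.init i (P.output i p)) id)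

theorem Protocol.trans_run (P : Protocol n B α β) (Q : Protocol n B β γ) (x : Fin n → α) :
    (P.trans R₁ Q).run (R₁ + R₂) x = Q.run R₂ (P.run R₁ x) := by
  have h₁ : ∀ r ≤ R₁, ∀ i, (P.trans R₁ Q).state x r i = .inl (P.state x r i) := by
    intro r
    induction r with
    | zero => intro _ i; rfl
    | succ r ih =>
      intro hr i
      have ih := ih (by omega)
      have hr' : r < R₁ := by omega
      simp only [Protocol.state, ih]
      simp [Protocol.trans, hr']
  -- After round `R₁` the state is still `.inl`; `Q.init` is applied only when the state is next
  -- read. The invariant therefore compares states after this pending conversion, which also covers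
  -- `R₂ = 0`.
  have h₂ : ∀ k i, ((P.trans R₁ Q).state x (R₁ + k) i).elim
      (fun p => Q.init i (P.output i p)) id = Q.state (P.run R₁ x) k i := by
    intro k
    induction k with
    | zero => intro i; simp [h₁ R₁ le_rfl i]; rfl
    | succ k ih =>
      intro i
      rw [← add_assoc]
      simp only [Protocol.state]
      simp only [← ih]
      simp [Protocol.trans]
  funext i
  exact congrArg (Q.output i) (h₂ R₂ i)

theorem Solvable.trans {t₁ : (Fin n → α) → (Fin n → β) → Prop}
    {t₂ : (Fin n → β) → (Fin n → γ) → Prop} (h₁ : Solvable R₁ B t₁) (h₂ : Solvable R₂ B t₂) :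
    Solvable (R₁ + R₂) B (fun x z => ∃ y, t₁ x y ∧ t₂ y z) := by
  obtain ⟨P, hP⟩ := h₁
  obtain ⟨Q, hQ⟩ := h₂
  exact ⟨P.trans R₁ Q, fun x => ⟨P.run R₁ x, hP x, by rw [P.trans_run]; exact hQ _⟩⟩

/-- A single round in which messages of type `τ` are exchanged. -/
theorem solvable_exchange [Nonempty τ] (hτ : Fits B τ) (send : Fin n → α → Fin n → τ)
    (recv : Fin n → α → (Fin n → τ) → β) :
    Solvable 1 B (fun (x : Fin n → α) y =>
      ∀ i, y i = recv i (x i) (fun j => send j (x j) i)) := by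
  obtain ⟨e⟩ := hτ
  let P : Protocol n B α β :=
    { State := α ⊕ β
      init := fun _ x => .inl x
      send := fun _ i s j => s.elim (fun a => e (send i a j)) (fun _ _ => false)
      receive := fun _ i s m =>
        s.elim (fun a => .inr (recv i a fun j => Function.invFun e (m j))) .inr
      output := fun i s => s.elim (fun a => recv i a fun _ => Classical.arbitrary τ) id }
  refine ⟨P, fun x i => ?_⟩
  simp [P, Protocol.run, Protocol.state, Function.leftInverse_invFun e.injective _]

/-- A single round in which every node tells all nodes a value of type `τ`. -/
theorem solvable_broadcast [Nonempty τ] (hτ : Fits B τ) (say : Fin n → α → τ)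
    (recv : Fin n → α → (Fin n → τ) → β) :
    Solvable 1 B (fun (x : Fin n → α) y => ∀ i, y i = recv i (x i) (fun j => say j (x j))) :=
  solvable_exchange hτ (fun i a _ => say i a) recv

end Compose

/-! ### Arrays distributed over the nodes -/

section Hosted

open Finset

variable {n B R R₁ R₂ : ℕ} {P T T' T'' : Type}

/-- The contents of an array with index type `P` when node `h p` is responsible for entry `p`. -/
def contents (h : P → Fin n) (x : Fin n → P → T) : P → T := fun p => x (h p) p

/-- `F` can be computed on arrays distributed according to `h`, with the result distributed
according to `h'`. -/
def HostedSolvable (R B : ℕ) (h h' : P → Fin n) (F : (P → T) → P → T') : Prop :=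
  Solvable R B (fun x y => contents h' y = F (contents h x))

theorem HostedSolvable.trans {h h' h'' : P → Fin n} {F : (P → T) → P → T'}
    {G : (P → T') → P → T''} (hF : HostedSolvable R₁ B h h' F)
    (hG : HostedSolvable R₂ B h' h'' G) : HostedSolvable (R₁ + R₂) B h h'' (G ∘ F) := by
  refine (Solvable.trans hF hG).imp ?_
  rintro x z ⟨y, hxy, hyz⟩
  rw [hyz, hxy, Function.comp_apply]

theorem hostedSolvable_local (B : ℕ) {h : P → Fin n} {F : (P → T) → P → T'}
    (hF : ∀ x y p, (∀ q, h q = h p → x q = y q) → F x p = F y p) :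
    HostedSolvable 0 B h h F := by
  refine (solvable_local 0 B (fun _ s => F s)).imp ?_
  intro x y hxy
  funext p
  rw [contents, hxy]
  exact hF _ _ _ fun q hq => by rw [contents, hq]

/-- Numbers the entries within each fibre; in `hostedSolvable_move` these labels are the slots of
the message between two nodes. -/
theorem exists_label [Fintype P] {ι : Type} [DecidableEq ι] (f : P → ι) (k : ℕ)
    (hf : ∀ c, #{p | f p = c} ≤ k) :
    ∃ e : P → Fin k, ∀ p q, f p = f q → e p = e q → p = q := by
  have : ∀ c, Nonempty ({p // f p = c} ↪ Fin k) := fun c =>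
    Function.Embedding.nonempty_of_card_le (by
      rw [Fintype.card_subtype, Fintype.card_fin]; exact hf c)
  let g := fun c => (this c).some
  refine ⟨fun p => g (f p) ⟨p, rfl⟩, fun p q hpq h => ?_⟩
  have key : ∀ c (hp : f p = c) (hq : f q = c), g c ⟨p, hp⟩ = g c ⟨q, hq⟩ → p = q :=
    fun c hp hq h => congrArg Subtype.val ((g c).injective h)
  have key' : ∀ c (hp : f p = c), g c ⟨p, hp⟩ = g (f p) ⟨p, rfl⟩ := by
    rintro c rfl
    rfl
  exact key _ hpq rfl ((key' _ hpq).trans h)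

/-- Both ends know `h`, `h'` and the slot numbering, so no addresses are transmitted. The default `x
p` in the decoding is never reached at the node responsible for `p`. -/
theorem hostedSolvable_move [Fintype P] {k : ℕ} (hT : Fits B (Fin k → Option T))
    {h h' : P → Fin n} (hk : ∀ i j, #{p | h p = i ∧ h' p = j} ≤ k) :
    HostedSolvable 1 B h h' (id : (P → T) → P → T) := by
  classical
  obtain ⟨e, he⟩ := exists_label (fun p => (h p, h' p)) k (by
    rintro ⟨i, j⟩
    simpa using hk i j)
  refine (solvable_exchange (α := P → T) (β := P → T) hT
    (fun i x j a => if hp : ∃ p, h p = i ∧ h' p = j ∧ e p = a then some (x hp.choose) else none)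
    (fun _ x m p => (m (h p) (e p)).getD (x p))).imp ?_
  intro x y hxy
  funext p
  have hp : ∃ q, h q = h p ∧ h' q = h' p ∧ e q = e p := ⟨p, rfl, rfl, rfl⟩
  have hq : hp.choose = p := he _ _ (Prod.ext hp.choose_spec.1 hp.choose_spec.2.1)
    hp.choose_spec.2.2
  simp only [contents, hxy, id]
  rw [dif_pos hp, Option.getD_some, hq]

/-- Greedy edge colouring of a bipartite multigraph with degrees at most `d`. -/
theorem exists_edge_coloring [Fintype P] {ι : Type} [DecidableEq ι] (h h' : P → ι) (d : ℕ)
    (hd : ∀ i, #{p | h p = i} ≤ d) (hd' : ∀ i, #{p | h' p = i} ≤ d) :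
    ∃ c : P → Fin (2 * d), (∀ p q, h p = h q → c p = c q → p = q) ∧
      ∀ p q, h' p = h' q → c p = c q → p = q := by
  classical
  rcases isEmpty_or_nonempty P with _ | ⟨⟨p₀⟩⟩
  · exact ⟨isEmptyElim, isEmptyElim, isEmptyElim⟩
  have hd0 : 0 < d := (card_pos.2 ⟨p₀, by simp⟩).trans_le (hd (h p₀))
  suffices ∀ S : Finset P, ∃ c : P → Fin (2 * d), ∀ p ∈ S, ∀ q ∈ S, h p = h q ∨ h' p = h' q →
      c p = c q → p = q by
    obtain ⟨c, hc⟩ := this univ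
    exact ⟨c, fun p q h₁ => hc p (mem_univ _) q (mem_univ _) (.inl h₁),
      fun p q h₁ => hc p (mem_univ _) q (mem_univ _) (.inr h₁)⟩
  intro S
  induction S using Finset.induction_on with
  | empty => exact ⟨fun _ => ⟨0, by omega⟩, by simp⟩
  | insert a S ha ih =>
    obtain ⟨c, hc⟩ := ih
    -- At either end `a` meets at most d - 1 edges of `S`, because `a` itself is counted in the
    -- degree and is not in `S`. So fewer than 2d colours are blocked.
    obtain ⟨v, hv⟩ : ∃ v : Fin (2 * d), v ∉ ({q ∈ S | h q = h a ∨ h' q = h' a}).image c := by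
      by_contra! hall
      have h₁ : 2 * d ≤ #{q ∈ S | h q = h a ∨ h' q = h' a} := by
        calc 2 * d = #(univ : Finset (Fin (2 * d))) := by simp
          _ ≤ #(({q ∈ S | h q = h a ∨ h' q = h' a}).image c) := card_le_card fun v _ => hall v
          _ ≤ _ := card_image_le
      have h₂ : ∀ g : P → ι, #{p | g p = g a} ≤ d → #{q ∈ S | g q = g a} < d := by
        intro g hg
        refine lt_of_lt_of_le (card_lt_card ?_) hg
        refine ⟨fun q hq => by simp at hq ⊢; exact hq.2, fun hsub => ha ?_⟩
        exact (mem_filter.1 (hsub (by simp : a ∈ _))).1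
      have h₃ := h₂ h (hd _)
      have h₄ := h₂ h' (hd' _)
      rw [filter_or] at h₁
      have := card_union_le {q ∈ S | h q = h a} {q ∈ S | h' q = h' a}
      omega
    have hv' : ∀ q ∈ S, h q = h a ∨ h' q = h' a → c q ≠ v := fun q hq hor hcv =>
      hv (mem_image.2 ⟨q, mem_filter.2 ⟨hq, hor⟩, hcv⟩)
    refine ⟨Function.update c a v, ?_⟩
    intro p hp q hq hor hpq
    by_cases hpa : p = a <;> by_cases hqa : q = a
    · rw [hpa, hqa]
    · subst hpa
      rw [Function.update_self, Function.update_of_ne hqa] at hpq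
      exact absurd hpq.symm (hv' q (mem_of_mem_insert_of_ne hq hqa) (by tauto))
    · subst hqa
      rw [Function.update_self, Function.update_of_ne hpa] at hpq
      exact absurd hpq (hv' p (mem_of_mem_insert_of_ne hp hpa) (by tauto))
    · rw [Function.update_of_ne hqa, Function.update_of_ne hpa] at hpq
      exact hc p (mem_of_mem_insert_of_ne hp hpa) q (mem_of_mem_insert_of_ne hq hqa) hor hpq

theorem card_filter_mod_le {n k : ℕ} (i : Fin n) :
    #{c : Fin (k * n) | c.1 % n = i} ≤ k := by
  calc #{c : Fin (k * n) | c.1 % n = i} ≤ #(range k) := by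
        refine card_le_card_of_injOn (fun c => c.1 / n) ?_ ?_
        · intro c _
          simpa using Nat.div_lt_of_lt_mul (c.2.trans_eq (mul_comm _ _))
        · intro c hc c' hc' h
          simp only [coe_filter, mem_univ, true_and, Set.mem_ofPred_eq] at hc hc' h
          ext
          rw [← Nat.div_add_mod c n, ← Nat.div_add_mod c' n, hc, hc', h]
    _ = k := card_range k

/-- If every node is responsible for at most `k * n` entries before and after, then the entries of
an array can be moved to their new nodes in two rounds. -/
theorem hostedSolvable_rehost [Fintype P] {k : ℕ} (hT : Fits B (Fin (2 * k) → Option T))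
    {h h' : P → Fin n} (hk : ∀ i, #{p | h p = i} ≤ k * n) (hk' : ∀ i, #{p | h' p = i} ≤ k * n) :
    HostedSolvable 2 B h h' (id : (P → T) → P → T) := by
  classical
  obtain ⟨c, hc, hc'⟩ := exists_edge_coloring h h' (k * n) hk hk'
  have hn : ∀ _ : P, 0 < n := fun p => (h p).pos
  -- The colour mod n names the relay. Each relay owns 2k of the 2kn colours, and entries with a
  -- common source (or target) have distinct colours, so at most 2k of them share a relay.
  let mid : P → Fin n := fun p => ⟨(c p).1 % n, Nat.mod_lt _ (hn p)⟩
  have key : ∀ g : P → Fin n, (∀ p q, g p = g q → c p = c q → p = q) →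
      ∀ i j, #{p | g p = i ∧ mid p = j} ≤ 2 * k := by
    intro g hg i j
    refine le_trans ?_ (card_filter_mod_le (k := 2 * k) j)
    refine card_le_card_of_injOn (fun p => (c p).cast (by ring)) ?_ ?_
    · intro p hp
      simp only [coe_filter, mem_univ, true_and, Set.mem_ofPred_eq] at hp ⊢
      exact congrArg Fin.val hp.2
    · intro p hp q hq hpq
      simp only [coe_filter, mem_univ, true_and, Set.mem_ofPred_eq] at hp hq
      exact hg p q (hp.1.trans hq.1.symm) (by simpa [Fin.ext_iff] using hpq)
  refine (hostedSolvable_move (h' := mid) hT (key h hc)).trans (hostedSolvable_move hT ?_)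
  intro i j
  simpa only [and_comm] using key h' hc' j i

end Hosted

open Finset

/-! ### Column sort on subsets of an interval of natural numbers -/

section NatColumnSort

/-- Push the elements of `Z ⊆ range N` to the front within each class of `l`. -/
def natClassSort (N : ℕ) (l : ℕ → ℕ) (Z : Finset ℕ) : Finset ℕ :=
  {a ∈ range N | #{b ∈ range a | l b = l a} < #{b ∈ Z | l b = l a}}

variable {N : ℕ} {l : ℕ → ℕ} {Z : Finset ℕ} {u v : ℕ}

/-- Everything before a position below `u` is already in `Z`, so a clean prefix survives sorting;
dually, the next lemma keeps a clean tail empty. -/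
theorem range_subset_natClassSort (hu : range u ⊆ Z) (hN : Z ⊆ range N) :
    range u ⊆ natClassSort N l Z := by
  intro a ha
  refine mem_filter.2 ⟨hN (hu ha), card_lt_card ⟨?_, ?_⟩⟩
  · intro b hb
    simp only [mem_filter, mem_range] at hb ha ⊢
    exact ⟨hu (mem_range.2 (hb.1.trans ha)), hb.2⟩
  · intro hsub
    have := hsub (mem_filter.2 ⟨hu ha, rfl⟩)
    simp at this

theorem natClassSort_subset_range (hv : Z ⊆ range v) : natClassSort N l Z ⊆ range v := by
  intro a ha
  by_contra hav
  refine absurd (mem_filter.1 ha).2 (not_lt.2 (card_le_card ?_))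
  intro b hb
  simp only [mem_filter, mem_range, not_lt] at hb hav ⊢
  exact ⟨(mem_range.1 (hv hb.1)).trans_le hav, hb.2⟩

/-- Only positions in [u, v) are undecided. They lie in one class, whose members below `u`
contribute equally to both counts; what remains is a - u < #Z - u. -/
theorem natClassSort_eq_range (hu : range u ⊆ Z) (hv : Z ⊆ range v) (hN : Z ⊆ range N)
    (hl : ∀ a b, u ≤ a → a < v → u ≤ b → b < v → l a = l b) :
    natClassSort N l Z = range #Z := by
  have huZ : u ≤ #Z := by simpa using card_le_card hu
  have hZv : #Z ≤ v := by simpa using card_le_card hv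
  have hZN : #Z ≤ N := by simpa using card_le_card hN
  ext a
  rw [mem_range]
  rcases lt_or_ge a u with hau | hau
  · exact iff_of_true (range_subset_natClassSort hu hN (mem_range.2 hau)) (hau.trans_le huZ)
  rcases lt_or_ge a v with hav | hav
  swap
  · exact iff_of_false (fun h => absurd (natClassSort_subset_range hv h) (by simpa using hav))
      (by omega)
  have h₁ : #{b ∈ range a | l b = l a} = #{b ∈ range u | l b = l a} + (a - u) := by
    have : {b ∈ range a | l b = l a} = {b ∈ range u | l b = l a} ∪ Ico u a := by
      ext b
      simp only [mem_filter, mem_range, mem_union, mem_Ico]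
      have := fun h1 h2 => hl b a h1 h2 hau hav
      grind
    rw [this, card_union_of_disjoint, Nat.card_Ico]
    rw [disjoint_left]
    intro b hb hb'
    simp only [mem_filter, mem_range, mem_Ico] at hb hb'
    omega
  have h₂ : #{b ∈ Z | l b = l a} = #{b ∈ range u | l b = l a} + (#Z - u) := by
    have : {b ∈ Z | l b = l a} = {b ∈ range u | l b = l a} ∪ (Z \ range u) := by
      ext b
      simp only [mem_filter, mem_range, mem_union, mem_sdiff]
      have h1 := fun h1 h2 => hl b a h1 h2 hau hav
      have h2 := @hu b
      have h3 := @hv b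
      simp only [mem_range] at h2 h3
      grind
    rw [this, card_union_of_disjoint, card_sdiff_of_subset hu, card_range]
    rw [disjoint_left]
    intro b hb hb'
    simp only [mem_filter, mem_sdiff] at hb hb'
    exact hb'.2 hb.1
  rw [natClassSort, mem_filter, mem_range, h₁, h₂]
  omega

theorem card_filter_range_div_eq (m a : ℕ) :
    #{b ∈ range a | b / m = a / m} = a % m := by
  rcases m.eq_zero_or_pos with rfl | hm
  · simp
  have : {b ∈ range a | b / m = a / m} = Ico (m * (a / m)) a := by
    ext b
    simp only [mem_filter, mem_range, mem_Ico]
    have := Nat.mul_div_le a m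
    constructor
    · rintro ⟨h, h'⟩
      exact ⟨h' ▸ Nat.mul_div_le b m, h⟩
    · rintro ⟨h, h'⟩
      refine ⟨h', le_antisymm (Nat.div_le_div_right h'.le) ?_⟩
      rwa [Nat.le_div_iff_mul_le hm, mul_comm]
  rw [this, Nat.card_Ico]
  have := Nat.div_add_mod a m
  omega

theorem card_filter_range_mod {s : ℕ} (hs : 0 < s) (z t : ℕ) (ht : t < s) :
    #{b ∈ range z | b % s = t} = z / s + if t < z % s then 1 else 0 := by
  have := Nat.count_modEq_card z hs t
  rw [Nat.count_eq_card_filter_range, Nat.mod_eq_of_lt ht] at this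
  rw [← this]
  congr 1
  ext b
  simp [Nat.ModEq, Nat.mod_eq_of_lt ht]

theorem card_filter_range_mod_eq {s : ℕ} (hs : 0 < s) (a : ℕ) :
    #{b ∈ range a | b % s = a % s} = a / s := by
  rw [card_filter_range_mod hs _ _ (Nat.mod_lt _ hs)]
  simp

/-- After sorting the windows and then the residue classes, only `s ^ 2` consecutive positions are
possibly out of order. -/
theorem exists_dirty_interval {s m : ℕ} (hs : 0 < s) (hsm : s ∣ m) (hZ : Z ⊆ range (s * m)) :
    ∃ A, range (A * s) ⊆ natClassSort (s * m) (· % s) (natClassSort (s * m) (· / m) Z) ∧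
      natClassSort (s * m) (· % s) (natClassSort (s * m) (· / m) Z) ⊆ range (A * s + s * s) := by
  set Z₁ := natClassSort (s * m) (· / m) Z
  let z : ℕ → ℕ := fun j => #{b ∈ Z | b / m = j}
  rcases m.eq_zero_or_pos with rfl | hm
  · refine ⟨0, by simp, fun a ha => ?_⟩
    simp [natClassSort] at ha
  have hz : ∀ j, z j ≤ m := by
    intro j
    calc z j ≤ #(Ico (m * j) (m * j + m)) := card_le_card fun b hb => by
          simp only [mem_filter, mem_Ico] at hb ⊢
          have := Nat.div_add_mod b m
          have := Nat.mod_lt b hm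
          rw [hb.2] at *
          omega
      _ = m := by simp
  have hsum : ∑ j ∈ range s, z j = #Z := by
    rw [card_eq_sum_card_fiberwise (f := (· / m)) (t := range s)]
    intro b hb
    have := mem_range.1 (hZ hb)
    simpa using Nat.div_lt_of_lt_mul (this.trans_eq (mul_comm _ _))
  -- A sorted window `j` is filled exactly at the positions m * j + e with e < z j, and s ∣ m makes
  -- the residue mod s of such a position that of e.
  have hcard : ∀ t < s, #{b ∈ Z₁ | b % s = t} = ∑ j ∈ range s, #{e ∈ range (z j) | e % s = t} := by
    intro t ht
    rw [card_eq_sum_card_fiberwise (f := (· / m)) (t := range s)]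
    · refine sum_congr rfl fun j hj => ?_
      rw [mem_range] at hj
      symm
      refine card_bij (fun e _ => m * j + e) ?_ ?_ ?_
      · intro e he
        simp only [mem_filter, mem_range] at he
        have hem : e < m := he.1.trans_le (hz j)
        have hdiv : (m * j + e) / m = j := by
          rw [Nat.mul_add_div hm, Nat.div_eq_of_lt hem, add_zero]
        have hmod : (m * j + e) % m = e := by
          rw [Nat.mul_add_mod, Nat.mod_eq_of_lt hem]
        simp only [mem_filter]
        refine ⟨⟨mem_filter.2 ⟨mem_range.2 ?_, ?_⟩, ?_⟩, hdiv⟩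
        · calc m * j + e < m * j + m := by omega
            _ = (j + 1) * m := by ring
            _ ≤ s * m := Nat.mul_le_mul_right _ hj
        · rw [card_filter_range_div_eq, hmod]
          simpa only [hdiv] using he.1
        · obtain ⟨d, rfl⟩ := hsm
          rw [mul_assoc, Nat.mul_add_mod]
          exact he.2
      · intro e _ e' _ h
        omega
      · intro b hb
        simp only [mem_filter] at hb
        obtain ⟨⟨hb₁, hbt⟩, rfl⟩ := hb
        have hb₂ := (mem_filter.1 hb₁).2
        rw [card_filter_range_div_eq] at hb₂
        refine ⟨b % m, mem_filter.2 ⟨mem_range.2 hb₂, ?_⟩, Nat.div_add_mod b m⟩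
        rw [Nat.mod_mod_of_dvd _ hsm, hbt]
    · intro b hb
      have := mem_range.1 (mem_filter.1 (mem_filter.1 hb).1).1
      simpa using Nat.div_lt_of_lt_mul (this.trans_eq (mul_comm _ _))
  have hlow : ∀ t < s, ∑ j ∈ range s, z j / s ≤ #{b ∈ Z₁ | b % s = t} := by
    intro t ht
    rw [hcard t ht]
    refine sum_le_sum fun j _ => ?_
    rw [card_filter_range_mod hs _ _ ht]
    omega
  have hupp : ∀ t < s, #{b ∈ Z₁ | b % s = t} ≤ ∑ j ∈ range s, z j / s + s := by
    intro t ht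
    rw [hcard t ht]
    calc _ ≤ ∑ j ∈ range s, (z j / s + 1) := by
          refine sum_le_sum fun j _ => ?_
          rw [card_filter_range_mod hs _ _ ht]
          split_ifs <;> omega
      _ = _ := by rw [sum_add_distrib]; simp
  -- Each window gives every residue class z j / s elements or one more, so over s windows the class
  -- sizes differ from this sum by at most s. A position `a` has a / s predecessors in its class.
  refine ⟨∑ j ∈ range s, z j / s, fun a ha => mem_filter.2 ⟨?_, ?_⟩, fun a ha => ?_⟩
  · have h₁ : (∑ j ∈ range s, z j / s) * s ≤ #Z := by
      rw [sum_mul, ← hsum]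
      exact sum_le_sum fun j _ => Nat.div_mul_le_self _ _
    have h₂ : #Z ≤ s * m := by simpa using card_le_card hZ
    rw [mem_range] at ha ⊢
    omega
  · rw [card_filter_range_mod_eq hs]
    refine lt_of_lt_of_le ?_ (hlow _ (Nat.mod_lt _ hs))
    exact Nat.div_lt_of_lt_mul ((mem_range.1 ha).trans_eq (mul_comm _ _))
  · have h := (mem_filter.1 ha).2
    rw [card_filter_range_mod_eq hs] at h
    have h' := h.trans_le (hupp _ (Nat.mod_lt _ hs))
    rw [Nat.div_lt_iff_lt_mul hs, add_mul] at h'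
    exact mem_range.2 h'

theorem natClassSort_range {k : ℕ} (hk : k ≤ N) : natClassSort N l (range k) = range k := by
  have := natClassSort_eq_range (N := N) (l := l) (Subset.refl (range k)) (Subset.refl _)
    (range_subset_range.2 hk) (by omega)
  simpa using this

/-- The elements with `p` have ranks 0, 1, 2, … among themselves. Applied class by class, this shows
that pushing to the front preserves cardinality. -/
theorem card_filter_count_lt (p : ℕ → Prop) [DecidablePred p] (k N : ℕ) :
    #{a ∈ range N | p a ∧ Nat.count p a < k} = min k (Nat.count p N) := by
  induction N with
  | zero => simp
  | succ N ih =>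
    rw [range_add_one, filter_insert, Nat.count_succ]
    by_cases hp : p N <;> by_cases hk : Nat.count p N < k
    · rw [if_pos ⟨hp, hk⟩, card_insert_of_notMem (by simp), ih, if_pos hp]
      omega
    · rw [if_neg (fun h => hk h.2), ih, if_pos hp]
      omega
    · rw [if_neg (fun h => hp h.1), ih, if_neg hp, add_zero]
    · rw [if_neg (fun h => hp h.1), ih, if_neg hp, add_zero]

theorem card_natClassSort (hZ : Z ⊆ range N) : #(natClassSort N l Z) = #Z := by
  rw [card_eq_sum_card_fiberwise (f := l) (s := Z) (t := (range N).image l)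
      fun a ha => mem_image_of_mem l (hZ ha),
    card_eq_sum_card_fiberwise (f := l) (s := natClassSort N l Z) (t := (range N).image l)
      fun a ha => mem_image_of_mem l (mem_filter.1 ha).1]
  refine sum_congr rfl fun c _ => ?_
  have h₁ : #{b ∈ Z | l b = c} ≤ Nat.count (l · = c) N := by
    rw [Nat.count_eq_card_filter_range]
    exact card_le_card (filter_subset_filter _ hZ)
  rw [← min_eq_left h₁, ← card_filter_count_lt]
  congr 1
  ext a
  simp only [natClassSort, mem_filter, Nat.count_eq_card_filter_range]
  constructor
  · rintro ⟨⟨h, h'⟩, rfl⟩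
    exact ⟨h, rfl, h'⟩
  · rintro ⟨h, rfl, h'⟩
    exact ⟨⟨h, h'⟩, rfl⟩

theorem natClassSort_columnSort {s m : ℕ} (hs : 0 < s) (hsm : s ∣ m) (hm : 2 * (s * s) ≤ m)
    (hZ : Z ⊆ range (s * m)) :
    natClassSort (s * m) (fun a => (a + m / 2) / m) (natClassSort (s * m) (· / m)
      (natClassSort (s * m) (· % s) (natClassSort (s * m) (· / m) Z))) = range #Z := by
  obtain ⟨A, hu, hv⟩ := exists_dirty_interval hs hsm hZ
  have h₁ : natClassSort (s * m) (· / m) Z ⊆ range (s * m) := natClassSort_subset_range hZ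
  have hN : natClassSort (s * m) (· % s) (natClassSort (s * m) (· / m) Z) ⊆ range (s * m) :=
    natClassSort_subset_range h₁
  have hcard : #(natClassSort (s * m) (· % s) (natClassSort (s * m) (· / m) Z)) = #Z := by
    rw [card_natClassSort h₁, card_natClassSort hZ]
  generalize natClassSort (s * m) (· % s) (natClassSort (s * m) (· / m) Z) = Z₂ at *
  have hm0 : 0 < m := by nlinarith
  have hs2 : s * s ≤ m / 2 := by omega
  have hs1 : 0 < s * s := by positivity
  generalize A * s = u at *
  generalize s * s = w at *
  -- Either the dirty interval lies in one window, so the third sort finishes and the fourth changes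
  -- nothing, or it crosses a window boundary. In the latter case, having length at most m / 2, it
  -- lies in one shifted window.
  by_cases hc : u / m = (u + w - 1) / m
  · rw [natClassSort_eq_range (l := (· / m)) hu hv hN, natClassSort_range, hcard]
    · simpa using card_le_card hN
    · have key : ∀ a, u ≤ a → a < u + w → a / m = u / m := fun a h h' =>
        le_antisymm (hc ▸ Nat.div_le_div_right (by omega)) (Nat.div_le_div_right h)
      intro a b ha ha' hb hb'
      exact (key a ha ha').trans (key b hb hb').symm
  · rw [natClassSort_eq_range (range_subset_natClassSort hu hN) (natClassSort_subset_range hv)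
      (natClassSort_subset_range hN), card_natClassSort hN, hcard]
    have hlt : u / m < (u + w - 1) / m :=
      lt_of_le_of_ne (Nat.div_le_div_right (by omega)) hc
    set j := (u + w - 1) / m with hj
    have hj₁ : j * m ≤ u + w - 1 := Nat.div_mul_le_self _ _
    have hj₂ : u < j * m := (Nat.div_lt_iff_lt_mul hm0).1 hlt
    have key : ∀ a, u ≤ a → a < u + w → (a + m / 2) / m = j := by
      intro a h h'
      rw [Nat.div_eq_iff hm0]
      omega
    intro a b ha ha' hb hb'
    exact (key a ha ha').trans (key b hb hb').symm

end NatColumnSort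

/-! ### Sorting an array within classes of positions -/

section ClassSort

variable {P T ι : Type} [Fintype P] [LinearOrder P] [LinearOrder T] [DecidableEq ι]

theorem _root_.List.Pairwise.getElem_iff_lt_countP {l : List T} (hl : l.Pairwise (· ≤ ·))
    (q : T → Bool) (hq : ∀ a b, a ≤ b → q b → q a) (i : ℕ) (hi : i < l.length) :
    q l[i] ↔ i < l.countP q := by
  induction l generalizing i with
  | nil => simp at hi
  | cons a l ih =>
    rw [List.pairwise_cons] at hl
    by_cases ha : q a
    · rw [List.countP_cons_of_pos ha]
      cases i with
      | zero => simpa using ha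
      | succ i => simpa using ih hl.2 i (by simpa using hi)
    · have h0 : l.countP q = 0 := List.countP_eq_zero.2 fun b hb hqb => ha (hq a b (hl.1 b hb) hqb)
      rw [List.countP_cons_of_neg ha, h0]
      refine iff_of_false (fun h => ha ?_) (by omega)
      cases i with
      | zero => exact h
      | succ i => exact hq _ _ (hl.1 _ (List.getElem_mem _)) h

/-- The rank of `p` within its class. -/
def classRank (κ : P → ι) (p : P) : ℕ := #{q | κ q = κ p ∧ q < p}

/-- Sort the array `x` within each class of `κ`. -/
def classSort (κ : P → ι) (x : P → T) (p : P) : T :=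
  ((({q | κ q = κ p} : Finset P).val.map x).sort (· ≤ ·)).getD (classRank κ p) (x p)

theorem classSort_congr (κ : P → ι) (x y : P → T) (p : P) (h : ∀ q, κ q = κ p → x q = y q) :
    classSort κ x p = classSort κ y p := by
  rw [classSort, classSort, h p rfl]
  congr 2
  exact Multiset.map_congr rfl fun q hq => h q (by simpa using hq)

variable {κ : P → ι}

theorem classRank_lt_card (p : P) : classRank κ p < #{q | κ q = κ p} := by
  refine card_lt_card ⟨fun q hq => ?_, fun h => ?_⟩
  · simp only [mem_filter, mem_univ, true_and] at hq ⊢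
    exact hq.1
  · have := h (show p ∈ _ by simp)
    simp at this

theorem classRank_lt_classRank {p q : P} (h : κ p = κ q) (hpq : p < q) :
    classRank κ p < classRank κ q := by
  refine card_lt_card ⟨fun r hr => ?_, fun hsub => ?_⟩
  · simp only [mem_filter, mem_univ, true_and] at hr ⊢
    exact ⟨hr.1.trans h, hr.2.trans hpq⟩
  · have := hsub (show p ∈ _ by simp [h, hpq])
    simp at this

theorem classRank_inj {p q : P} (h : κ p = κ q) (hr : classRank κ p = classRank κ q) : p = q := by
  by_contra hne
  rcases lt_or_gt_of_ne hne with hlt | hlt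
  · exact (classRank_lt_classRank h hlt).ne hr
  · exact (classRank_lt_classRank h.symm hlt).ne hr.symm

theorem image_classRank_class (κ : P → ι) (c : ι) :
    image (classRank κ) {q | κ q = c} = range #{q | κ q = c} := by
  refine eq_of_subset_of_card_le (fun a ha => ?_) ?_
  · simp only [mem_image, mem_filter, mem_univ, true_and] at ha
    obtain ⟨q, rfl, rfl⟩ := ha
    exact mem_range.2 (classRank_lt_card q)
  · rw [card_range, card_image_of_injOn]
    intro p hp q hq hpq
    simp only [coe_filter, mem_univ, true_and, Set.mem_ofPred_eq] at hp hq
    exact classRank_inj (hp.trans hq.symm) hpq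

theorem image_classRank_below (p : P) :
    image (classRank κ) {q | κ q = κ p ∧ q < p} = range (classRank κ p) := by
  refine eq_of_subset_of_card_le (fun a ha => ?_) ?_
  · simp only [mem_image, mem_filter, mem_univ, true_and] at ha
    obtain ⟨q, hq, rfl⟩ := ha
    exact mem_range.2 (classRank_lt_classRank hq.1 hq.2)
  · rw [card_range, card_image_of_injOn]
    · rfl
    intro q hq r hr hqr
    simp only [coe_filter, mem_univ, true_and, Set.mem_ofPred_eq] at hq hr
    exact classRank_inj (hq.1.trans hr.1.symm) hqr

/-- Comparisons with all thresholds determine an entry, so sorting becomes pure counting: the basis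
of the 0–1 principle. The default value in `classSort` is never used, since a rank is less than the
size of its class. -/
theorem classSort_le_iff (x : P → T) (p : P) (t : T) :
    classSort κ x p ≤ t ↔ classRank κ p < #{q | κ q = κ p ∧ x q ≤ t} := by
  set l := (({q | κ q = κ p} : Finset P).val.map x).sort (· ≤ ·) with hl
  have hlen : classRank κ p < l.length := by
    rw [hl, Multiset.length_sort, Multiset.card_map]
    exact classRank_lt_card p
  have hcount : l.countP (· ≤ t) = #{q | κ q = κ p ∧ x q ≤ t} := by
    rw [← Multiset.coe_countP, hl, Multiset.sort_eq, Multiset.countP_map, ← filter_filter]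
    rfl
  rw [← hcount, classSort, List.getD_eq_getElem _ _ hlen,
    ← (Multiset.pairwise_sort _ _).getElem_iff_lt_countP (fun a => a ≤ t) ?_ _ hlen]
  · exact decide_eq_true_iff.symm
  · intro a b hab hb
    simp only [decide_eq_true_eq] at hb ⊢
    exact hab.trans hb

/-- The ranks of the entries that are at most `t` in the class `c`. -/
def profile (κ : P → ι) (c : ι) (t : T) (x : P → T) : Finset ℕ :=
  image (classRank κ) {q | κ q = c ∧ x q ≤ t}

theorem classRank_mem_profile (p : P) (t : T) (x : P → T) :
    classRank κ p ∈ profile κ (κ p) t x ↔ x p ≤ t := by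
  simp only [profile, mem_image, mem_filter, mem_univ, true_and]
  constructor
  · rintro ⟨q, ⟨hq, hqt⟩, hqp⟩
    rwa [← classRank_inj hq hqp]
  · intro h
    exact ⟨p, ⟨rfl, h⟩, rfl⟩

theorem profile_subset (c : ι) (t : T) (x : P → T) :
    profile κ c t x ⊆ range #{q | κ q = c} := by
  rw [← image_classRank_class]
  refine image_subset_image fun q hq => ?_
  simp only [mem_filter, mem_univ, true_and] at hq ⊢
  exact hq.1

theorem card_profile (c : ι) (t : T) (x : P → T) :
    #(profile κ c t x) = #{q | κ q = c ∧ x q ≤ t} := by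
  refine card_image_of_injOn ?_
  intro q hq r hr hqr
  simp only [coe_filter, mem_univ, true_and, Set.mem_ofPred_eq] at hq hr
  exact classRank_inj (hq.1.trans hr.1.symm) hqr

/-- The 0–1 principle: thresholding commutes with sorting. Within a class of `κ`, ranks identify
entries with natural numbers, and the rank in a refined class counts the smaller ranks with the same
label. -/
theorem profile_classSort_refine {N : ℕ} (l : ℕ → ℕ) (c : ι) (hN : #{q | κ q = c} ≤ N) (t : T)
    (x : P → T) :
    profile κ c t (classSort (fun p => (κ p, l (classRank κ p))) x) =
      natClassSort N l (profile κ c t x) := by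
  set κ' : P → ι × ℕ := fun p => (κ p, l (classRank κ p)) with hκ'
  have hsub := profile_subset (κ := κ) c t x
  have key : ∀ p, κ p = c → (classSort κ' x p ≤ t ↔
      classRank κ p ∈ natClassSort N l (profile κ c t x)) := by
    rintro p rfl
    rw [classSort_le_iff]
    have h₁ : classRank κ' p = #{b ∈ range (classRank κ p) | l b = l (classRank κ p)} := by
      rw [← image_classRank_below, filter_image, card_image_of_injOn]
      · rw [classRank, filter_filter]
        congr 1
        ext q
        simp only [hκ', mem_filter, mem_univ, true_and, Prod.mk.injEq]
        tauto
      · intro q hq r hr hqr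
        simp only [coe_filter, mem_filter, mem_univ, true_and, Set.mem_ofPred_eq] at hq hr
        exact classRank_inj (hq.1.1.trans hr.1.1.symm) hqr
    have h₂ : #{q | κ' q = κ' p ∧ x q ≤ t} =
        #{b ∈ profile κ (κ p) t x | l b = l (classRank κ p)} := by
      rw [profile, filter_image, card_image_of_injOn]
      · rw [filter_filter]
        congr 1
        ext q
        simp only [hκ', mem_filter, mem_univ, true_and, Prod.mk.injEq]
        tauto
      · intro q hq r hr hqr
        simp only [coe_filter, mem_filter, mem_univ, true_and, Set.mem_ofPred_eq] at hq hr
        exact classRank_inj (hq.1.1.trans hr.1.1.symm) hqr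
    rw [h₁, h₂, natClassSort, mem_filter, mem_range]
    have := (classRank_lt_card (κ := κ) p).trans_le hN
    tauto
  ext a
  constructor
  · intro ha
    obtain ⟨p, hp, rfl⟩ := mem_image.1 ha
    simp only [mem_filter, mem_univ, true_and] at hp
    exact (key p hp.1).1 hp.2
  · intro ha
    have ha' := natClassSort_subset_range hsub ha
    rw [← image_classRank_class] at ha'
    obtain ⟨p, hp, rfl⟩ := mem_image.1 ha'
    simp only [mem_filter, mem_univ, true_and] at hp
    subst hp
    rw [classRank_mem_profile]
    exact (key p rfl).2 ha

/-- Column sort, performed simultaneously in all classes of `κ`. -/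
theorem classSort_columnSort (κ : P → ι) {s m : ℕ} (hs : 0 < s) (hsm : s ∣ m)
    (hm : 2 * (s * s) ≤ m) (hκ : ∀ c, #{q | κ q = c} ≤ s * m) (x : P → T) :
    classSort (fun p => (κ p, (classRank κ p + m / 2) / m))
      (classSort (fun p => (κ p, classRank κ p / m))
        (classSort (fun p => (κ p, classRank κ p % s))
          (classSort (fun p => (κ p, classRank κ p / m)) x))) = classSort κ x := by
  funext p
  refine eq_of_forall_ge_iff fun t => ?_
  have hN := hκ (κ p)
  have hZ : profile κ (κ p) t x ⊆ range (s * m) :=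
    (profile_subset _ _ _).trans (range_subset_range.2 hN)
  rw [← classRank_mem_profile (κ := κ), profile_classSort_refine (fun a => (a + m / 2) / m) _ hN,
    profile_classSort_refine (fun a => a / m) _ hN, profile_classSort_refine (fun a => a % s) _ hN,
    profile_classSort_refine (fun a => a / m) _ hN, natClassSort_columnSort hs hsm hm hZ,
    mem_range, card_profile, classSort_le_iff]

end ClassSort

/-! ### Distributed sorting -/

section DistributedSort

variable {n B R : ℕ} {P T ι : Type} [Fintype P] [LinearOrder P] [LinearOrder T] [DecidableEq ι]

/-- Class `c` is gathered at node `f c` in two rounds, sorted there without communication, and sent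
back in two rounds. -/
theorem hostedSolvable_classSort {k : ℕ} (hT : Fits B (Fin (2 * k) → Option T)) {h : P → Fin n}
    (hk : ∀ i, #{p | h p = i} ≤ k * n) (κ : P → ι) (f : ι → Fin n)
    (hf : ∀ i, #{p | f (κ p) = i} ≤ k * n) :
    HostedSolvable 4 B h h (classSort κ : (P → T) → P → T) :=
  ((hostedSolvable_rehost hT hk hf).trans (hostedSolvable_local B fun x y p hxy =>
    classSort_congr κ x y p fun q hq => hxy q (congrArg f hq))).trans
      (hostedSolvable_rehost hT hf hk)

theorem hostedSolvable_columnSort {h : P → Fin n} (κ : P → ι) {s m : ℕ} (hs : 0 < s) (hsm : s ∣ m)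
    (hm : 2 * (s * s) ≤ m) (hκ : ∀ c, #{q | κ q = c} ≤ s * m)
    (h₁ : HostedSolvable R B h h
      (classSort fun p => (κ p, classRank κ p / m) : (P → T) → P → T))
    (h₂ : HostedSolvable R B h h
      (classSort fun p => (κ p, classRank κ p % s) : (P → T) → P → T))
    (h₃ : HostedSolvable R B h h
      (classSort fun p => (κ p, (classRank κ p + m / 2) / m) : (P → T) → P → T)) :
    HostedSolvable (4 * R) B h h (classSort κ : (P → T) → P → T) := by
  have := ((h₁.trans h₂).trans h₁).trans h₃
  have hR : R + R + R + R = 4 * R := by ring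
  rw [hR] at this
  convert this using 1
  funext x
  exact (classSort_columnSort κ hs hsm hm hκ x).symm

/-- The map `l` divides `range (s * m)` into at most `s + 1` classes with at most `m` elements. -/
def IsDivision (s m : ℕ) (l : ℕ → ℕ) : Prop :=
  (∀ b < s * m, l b ≤ s) ∧ ∀ j, #{b ∈ range (s * m) | l b = j} ≤ m

/-- The shift may cut the first window short and spill into one extra window, hence the s + 1
classes allowed by `IsDivision`. -/
theorem isDivision_shift {s m d : ℕ} (hm : 0 < m) (hd : d ≤ m) :
    IsDivision s m (fun b => (b + d) / m) := by
  constructor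
  · intro b hb
    rw [← Nat.lt_succ_iff, Nat.div_lt_iff_lt_mul hm, Nat.succ_mul]
    omega
  · intro j
    calc _ ≤ #(Ico (m * j) (m * j + m)) := by
          refine card_le_card_of_injOn (· + d) ?_ ?_
          · intro b hb
            simp only [coe_filter, mem_range, Set.mem_ofPred_eq, coe_Ico, Set.mem_Ico] at hb ⊢
            have h₁ := Nat.div_add_mod (b + d) m
            have h₂ := Nat.mod_lt (b + d) hm
            rw [hb.2] at h₁
            omega
          · intro b _ b' _ hbb'
            simpa using hbb'
      _ = m := by simp

theorem isDivision_div {s m : ℕ} (hm : 0 < m) : IsDivision s m (fun b => b / m) :=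
  isDivision_shift (d := 0) hm (Nat.zero_le _)

theorem isDivision_mod {s m : ℕ} (hs : 0 < s) : IsDivision s m (fun b => b % s) := by
  refine ⟨fun b _ => (Nat.mod_lt b hs).le, fun j => ?_⟩
  rcases lt_or_ge j s with hj | hj
  · rw [card_filter_range_mod hs _ _ hj]
    simp [hs]
  · rw [filter_false_of_mem]
    · simp
    · intro b _ h
      exact absurd (h ▸ Nat.mod_lt b hs) (not_lt.2 hj)

theorem IsDivision.card_refine {κ : P → ι} {s m : ℕ} {l : ℕ → ℕ} (hl : IsDivision s m l)
    (hκ : ∀ c, #{q | κ q = c} ≤ s * m) (c : ι × ℕ) :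
    #{q | (κ q, l (classRank κ q)) = c} ≤ m := by
  refine le_trans ?_ (hl.2 c.2)
  refine card_le_card_of_injOn (classRank κ) ?_ ?_
  · intro q hq
    simp only [coe_filter, mem_univ, true_and, mem_range, Set.mem_ofPred_eq] at hq ⊢
    exact ⟨(classRank_lt_card q).trans_le (hκ _), congrArg Prod.snd hq⟩
  · intro q hq r hr hqr
    simp only [coe_filter, mem_univ, true_and, Set.mem_ofPred_eq] at hq hr
    exact classRank_inj (congrArg Prod.fst (hq.trans hr.symm)) hqr

theorem IsDivision.apply_classRank_le {κ : P → ι} {s m : ℕ} {l : ℕ → ℕ} (hl : IsDivision s m l)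
    (hκ : ∀ c, #{q | κ q = c} ≤ s * m) (p : P) : l (classRank κ p) ≤ s :=
  hl.1 _ ((classRank_lt_card p).trans_le (hκ _))

/-- Sorting an array of at most `n ^ 2` entries, with `O(n)` entries at each node. -/
theorem hostedSolvable_sort (hn : 0 < n) (hT : Fits B (Fin 144 → Option T)) {h : P → Fin n}
    (hP : Fintype.card P ≤ n * n) (hh : ∀ i, #{p | h p = i} ≤ 72 * n) :
    HostedSolvable 64 B h h (classSort (fun _ => ()) : (P → T) → P → T) := by
  -- This choice gives n ≤ s² ≤ 4n. With m = 2s² the capacity s * (s * m) = 2s⁴ covers n² entries,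
  -- while a leaf class has at most m ≤ 8n.
  obtain ⟨s, hsdef⟩ : ∃ s, s = Nat.sqrt n + 1 := ⟨_, rfl⟩
  have hs : 0 < s := by omega
  have hns : n ≤ s * s := hsdef ▸ (Nat.sqrt_lt.1 (Nat.lt_succ_self n.sqrt)).le
  have hsn : Nat.sqrt n * Nat.sqrt n ≤ n := Nat.sqrt_le n
  have hs1 : 1 ≤ Nat.sqrt n := Nat.sqrt_pos.2 hn
  have hs4 : s * s ≤ 4 * n := by rw [hsdef]; nlinarith
  have hs9 : (s + 1) * (s + 1) ≤ 9 * n := by rw [hsdef]; nlinarith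
  obtain ⟨m, hm⟩ : ∃ m, m = 2 * (s * s) := ⟨_, rfl⟩
  have hm0 : 0 < m := by rw [hm]; positivity
  have hsm0 : 0 < s * m := by positivity
  have hcode : ∀ a b, a ≤ s → b ≤ s → a * (s + 1) + b < 9 * n := by
    intro a b ha hb
    nlinarith [Nat.mul_le_mul_right (s + 1) ha]
  -- At most (s + 1)² ≤ 9n leaf classes exist. Their codes mod n put at most 9 of them on a node,
  -- hence at most 9m ≤ 72n entries. Each of the two levels of column sort multiplies the four
  -- rounds by 4.
  have leaf : ∀ κ : P → (Unit × ℕ) × ℕ, (∀ p, (κ p).1.2 ≤ s) → (∀ p, (κ p).2 ≤ s) →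
      (∀ c, #{q | κ q = c} ≤ m) →
      HostedSolvable 4 B h h (classSort κ : (P → T) → P → T) := by
    intro κ h₁ h₂ h₃
    refine hostedSolvable_classSort (k := 72) hT hh κ
      (fun c => ⟨(c.1.2 * (s + 1) + c.2) % n, Nat.mod_lt _ hn⟩) fun i => ?_
    let g : P → Fin (9 * n) := fun p =>
      ⟨(κ p).1.2 * (s + 1) + (κ p).2, hcode _ _ (h₁ p) (h₂ p)⟩
    have hle := card_le_mul_card_image_of_maps_to (f := g)
      (s := ({p | (⟨((κ p).1.2 * (s + 1) + (κ p).2) % n, Nat.mod_lt _ hn⟩ : Fin n) = i} : Finset P))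
      (t := {c : Fin (9 * n) | c.1 % n = i}) (fun p hp => by
        simp only [mem_filter, mem_univ, true_and] at hp ⊢
        exact congrArg Fin.val hp) m (fun c _ => by
        rcases Finset.eq_empty_or_nonempty ({a ∈ ({p | (⟨((κ p).1.2 * (s + 1) + (κ p).2) % n,
          Nat.mod_lt _ hn⟩ : Fin n) = i} : Finset P) | g a = c}) with he | ⟨p, hp⟩
        · rw [he]; simp
        refine le_trans (card_le_card ?_) (h₃ (κ p))
        intro q hq
        simp only [mem_filter, mem_univ, true_and] at hp hq ⊢
        have hpq := congrArg Fin.val (hq.2.trans hp.2.symm)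
        simp only [g] at hpq
        have hq₂ := h₂ q
        have hp₂ := h₂ p
        have e₁ : (κ q).1.2 = (κ p).1.2 := by
          have := congrArg (· / (s + 1)) hpq
          simpa [mul_comm _ (s + 1), Nat.mul_add_div,
            Nat.div_eq_of_lt (Nat.lt_succ_of_le hq₂), Nat.div_eq_of_lt (Nat.lt_succ_of_le hp₂)]
            using this
        rw [e₁] at hpq
        exact Prod.ext (Prod.ext rfl e₁) (by omega))
    have := card_filter_mod_le (k := 9) i
    refine hle.trans ?_
    calc m * _ ≤ m * 9 := Nat.mul_le_mul_left _ this
      _ ≤ 72 * n := by omega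
  have inner : ∀ l : ℕ → ℕ, IsDivision s (s * m) l →
      HostedSolvable 16 B h h (classSort (fun p : P =>
        ((), l (classRank (fun _ : P => ()) p))) : (P → T) → P → T) := by
    intro l hl
    have hcard : ∀ c : Unit, #{q : P | () = c} ≤ s * (s * m) := by
      intro c
      simp only [filter_true]
      refine hP.trans ?_
      calc n * n ≤ (s * s) * (s * s) := Nat.mul_le_mul hns hns
        _ ≤ s * (s * m) := by rw [hm]; nlinarith
    have hκ := hl.card_refine (κ := fun _ : P => ()) hcard
    have hle := hl.apply_classRank_le (κ := fun _ : P => ()) hcard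
    set κ : P → Unit × ℕ := fun p => ((), l (classRank (fun _ : P => ()) p)) with hκdef
    have step : ∀ l' : ℕ → ℕ, IsDivision s m l' → HostedSolvable 4 B h h
        (classSort (fun p : P => (κ p, l' (classRank κ p))) : (P → T) → P → T) := fun l' hl' =>
      leaf _ hle (hl'.apply_classRank_le hκ) (hl'.card_refine hκ)
    have hdvd : s ∣ m := Dvd.intro_left (2 * s) (by rw [hm]; ring)
    exact hostedSolvable_columnSort (R := 4) κ hs hdvd hm.ge hκ
      (step (fun b => b / m) (isDivision_div hm0)) (step (fun b => b % s) (isDivision_mod hs))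
      (step (fun b => (b + m / 2) / m) (isDivision_shift hm0 (Nat.div_le_self _ _)))
  refine hostedSolvable_columnSort (R := 16) (m := s * m) _ hs (Dvd.intro _ rfl) ?_ ?_
    (inner (fun b => b / (s * m)) (isDivision_div hsm0))
    (inner (fun b => b % s) (isDivision_mod hs))
    (inner (fun b => (b + s * m / 2) / (s * m)) (isDivision_shift hsm0 (Nat.div_le_self _ _)))
  · rw [← hm]
    exact Nat.le_mul_of_pos_left _ hs
  · intro c
    simp only [filter_true]
    refine hP.trans ?_
    calc n * n ≤ (s * s) * (s * s) := Nat.mul_le_mul hns hns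
      _ ≤ s * (s * m) := by rw [hm]; nlinarith

end DistributedSort

/-! ### Ranks of all keys -/

section SortPerm

variable {P T : Type} [Fintype P] [LinearOrder P] [LinearOrder T]

/-- `classSort` speaks of values only; a sorting permutation also tells from which position each
sorted entry came. -/
theorem classSort_const_eq {x : P → T} {σ : Equiv.Perm P} (h : Monotone (x ∘ σ)) :
    classSort (fun _ => ()) x = x ∘ σ := by
  funext p
  refine eq_of_forall_ge_iff fun t => ?_
  rw [classSort_le_iff]
  have hcard : #{q | () = () ∧ x q ≤ t} = #{q | x (σ q) ≤ t} := by
    symm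
    refine card_bij (fun q _ => σ q) ?_ ?_ ?_
    · intro q hq
      simpa using hq
    · intro q _ r _ hqr
      exact σ.injective hqr
    · intro q hq
      exact ⟨σ.symm q, by simpa using hq, by simp⟩
  rw [hcard, classRank]
  constructor
  · intro hlt
    by_contra hp
    refine absurd hlt (not_lt.2 (card_le_card fun r hr => ?_))
    simp only [mem_filter, mem_univ, true_and] at hr ⊢
    by_contra! hpr
    exact hp ((h hpr).trans hr)
  · intro hp
    refine card_lt_card ⟨fun r hr => ?_, fun hsub => ?_⟩
    · simp only [mem_filter, mem_univ, true_and] at hr ⊢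
      exact (h hr.le).trans hp
    · have := hsub (show p ∈ _ by simpa using hp)
      simp at this

theorem exists_perm_monotone (x : P → T) : ∃ σ : Equiv.Perm P, Monotone (x ∘ σ) := by
  let e : Fin (Fintype.card P) ≃o P := Fintype.orderIsoFinOfCardEq P rfl
  refine ⟨e.symm.toEquiv.trans ((Tuple.sort (x ∘ e)).trans e.toEquiv), ?_⟩
  exact (Tuple.monotone_sort (x ∘ e)).comp e.symm.monotone

end SortPerm

/-! ### Delivery on the n × n grid, and ranks from row summaries -/

section Grid

variable {n B : ℕ}

/-- Node `i` is responsible for the entries in row `i`. -/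
def row (p : Fin n ×ₗ Fin n) : Fin n := (ofLex p).1

theorem card_filter_row_le (i : Fin n) : #{p | row p = i} ≤ 72 * n := by
  calc #{p | row p = i} ≤ #(univ : Finset (Fin n)) := by
        refine card_le_card_of_injOn (fun p => (ofLex p).2) (fun _ _ => by simp) ?_
        intro p hp q hq hpq
        simp only [coe_filter, mem_univ, true_and, Set.mem_ofPred_eq] at hp hq
        exact ofLex.injective (Prod.ext (hp.trans hq.symm) hpq)
    _ ≤ 72 * n := by simp; omega

theorem solvable_sort (hn : 0 < n) {T : Type} [LinearOrder T] (hT : Fits B (Fin 144 → Option T)) :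
    HostedSolvable 64 B row row
      (classSort (fun _ => ()) : (Fin n ×ₗ Fin n → T) → Fin n ×ₗ Fin n → T) := by
  refine hostedSolvable_sort hn hT ?_ card_filter_row_le
  rw [← Fintype.card_congr (toLex : Fin n × Fin n ≃ _)]
  simp

/-- If each entry carries the index of the entry it belongs to, then all entries can be moved
there. -/
theorem solvable_deliver (hn : 0 < n) {E : Type}
    (hT : Fits B (Fin 144 → Option ((Fin n ×ₗ Fin n) × E))) :
    Solvable 64 B (fun (x : Fin n → Fin n ×ₗ Fin n → (Fin n ×ₗ Fin n) × E)
      (y : Fin n → Fin n → E) => ∀ σ : Equiv.Perm (Fin n ×ₗ Fin n),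
        (∀ q, (contents row x q).1 = σ q) →
          ∀ q, y (row (σ q)) (ofLex (σ q)).2 = (contents row x q).2) := by
  -- Any order will do: the addresses are distinct, so the payload never decides a comparison.
  let _ : LinearOrder E := IsWellOrder.linearOrder WellOrderingRel
  have hsort := solvable_sort hn (T := (Fin n ×ₗ Fin n) ×ₗ E) hT
  refine (((solvable_local 0 B fun _ s p => toLex (s p)).trans hsort).trans
    (solvable_local 0 B fun i (s : Fin n ×ₗ Fin n → (Fin n ×ₗ Fin n) ×ₗ E) a =>
      (ofLex (s (toLex (i, a)))).2)).imp ?_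
  rintro x y ⟨w, ⟨v, hv, hw⟩, hy⟩ σ hσ q
  have hmono : Monotone (contents row v ∘ σ.symm) := by
    intro p p' hpp'
    have h : ∀ p, contents row v (σ.symm p) = toLex (p, (contents row x (σ.symm p)).2) := by
      intro p
      have := hσ (σ.symm p)
      rw [Equiv.apply_symm_apply] at this
      simp only [contents, hv] at this ⊢
      exact congrArg toLex (Prod.ext this rfl)
    simp only [Function.comp_apply, h]
    rcases hpp'.eq_or_lt with rfl | hlt
    · exact le_rfl
    · exact (Prod.Lex.toLex_le_toLex).2 (.inl hlt)
  rw [classSort_const_eq hmono] at hw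
  have := congrFun hw (σ q)
  simp only [Function.comp_apply, Equiv.symm_apply_apply] at this
  rw [hy]
  simp only [contents] at this
  change (ofLex (w (row (σ q)) (σ q))).2 = _
  rw [this, hv]
  rfl

theorem card_filter_grid {S : Type} (w : Fin n ×ₗ Fin n → S) (q : S → Prop) [DecidablePred q] :
    #{p | q (w p)} = ∑ j, #{a | q (w (toLex (j, a)))} := by
  simp only [card_filter]
  rw [← Equiv.sum_comp (toLex : Fin n × Fin n ≃ Fin n ×ₗ Fin n), Fintype.sum_prod_type]

variable {S : Type} [LinearOrder S]

/-- The value `t`, the number of entries of `w` that are less than `t`, the number of those that are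
at most `t`, and the number of distinct values of `w` that are at most `t`. -/
def entry (w : Fin n ×ₗ Fin n → S) (t : S) :
    S × Fin (n * n + 1) × Fin (n * n + 1) × Fin (n * n + 1) :=
  (t, Fin.ofNat _ #{p | w p < t}, Fin.ofNat _ #{p | w p ≤ t},
    Fin.ofNat _ #{b ∈ univ.image w | b ≤ t})

/-- The part of a sorted row that the other nodes need: the first and the last value, the number of
copies of the first value, the number of values before the last one, and the number of distinct
values. -/
def rowSummary (hn : 0 < n) (ω : Fin n → S) :
    S × S × Fin (n * n + 1) × Fin (n * n + 1) × Fin (n * n + 1) :=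
  (ω ⟨0, hn⟩, ω ⟨n - 1, by omega⟩, Fin.ofNat _ #{a | ω a ≤ ω ⟨0, hn⟩},
    Fin.ofNat _ #{a | ω a < ω ⟨n - 1, by omega⟩}, Fin.ofNat _ #(univ.image ω))

/-- The computation of `entry` at node `i` from the summaries of all rows. -/
def rowEntry (i : Fin n) (ω : Fin n → S)
    (m : Fin n → S × S × Fin (n * n + 1) × Fin (n * n + 1) × Fin (n * n + 1)) (t : S) :
    S × Fin (n * n + 1) × Fin (n * n + 1) × Fin (n * n + 1) :=
  (t,
    Fin.ofNat _ (∑ j, if j < i then (if (m j).2.1 < t then n else (m j).2.2.2.1.1)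
      else if j = i then #{a | ω a < t} else 0),
    Fin.ofNat _ (∑ j, if j < i then n
      else if j = i then #{a | ω a ≤ t} else if (m j).1 ≤ t then (m j).2.2.1.1 else 0),
    Fin.ofNat _ (∑ j, if j ≤ i then
      (if j = i then #{b ∈ univ.image ω | b ≤ t} else (m j).2.2.2.2.1) -
        (if ∃ j' < j, (m j').2.1 = (m j).1 then 1 else 0) else 0))

theorem val_ofNat_of_le {v : ℕ} (hv : v ≤ n) : (Fin.ofNat (n * n + 1) v).1 = v := by
  rw [Fin.val_ofNat, Nat.mod_eq_of_lt]
  nlinarith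

/-- For `t` in row `i`, an earlier row has entries not below `t` only if its last value is `t`, and
a later row has entries up to `t` only if its first value is `t`. For distinct values, each value is
counted in the first row containing it; only the first value of a row can have occurred earlier, and
then it is the last value of an earlier row. -/
theorem rowEntry_eq (hn : 0 < n) {w : Fin n ×ₗ Fin n → S} (hw : Monotone w) (i b : Fin n) :
    rowEntry i (fun a => w (toLex (i, a)))
      (fun j => rowSummary hn fun a => w (toLex (j, a))) (w (toLex (i, b))) =
        entry w (w (toLex (i, b))) := by
  have hrow : ∀ j a a', a ≤ a' → w (toLex (j, a)) ≤ w (toLex (j, a')) := fun j a a' h =>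
    hw (Prod.Lex.toLex_le_toLex.2 (.inr ⟨rfl, h⟩))
  have hcol : ∀ j j' a a', j < j' → w (toLex (j, a)) ≤ w (toLex (j', a')) := fun j j' a a' h =>
    hw (Prod.Lex.toLex_le_toLex.2 (.inl h))
  have hfirst : ∀ j a, w (toLex (j, ⟨0, hn⟩)) ≤ w (toLex (j, a)) := fun j a =>
    hrow j _ _ (Fin.mk_le_of_le_val (Nat.zero_le _))
  have hlast : ∀ j a, w (toLex (j, a)) ≤ w (toLex (j, ⟨n - 1, by omega⟩)) := fun j a =>
    hrow j _ _ (Fin.le_def.2 (by simp; omega))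
  have hcard : ∀ s : Finset (Fin n), #s ≤ n := fun s => by simpa using card_le_univ s
  set t := w (toLex (i, b)) with ht
  refine Prod.ext rfl (Prod.ext ?_ (Prod.ext ?_ ?_))
  · refine congrArg (Fin.ofNat _) ?_
    rw [card_filter_grid w (· < t)]
    refine sum_congr rfl fun j _ => ?_
    simp only [rowSummary, val_ofNat_of_le (hcard _)]
    rcases lt_trichotomy j i with hj | rfl | hj
    · rw [if_pos hj]
      split_ifs with hlt
      · rw [filter_true_of_mem fun a _ => (hlast j a).trans_lt hlt]
        simp
      · have : w (toLex (j, ⟨n - 1, by omega⟩)) = t := le_antisymm (hcol _ _ _ _ hj) (not_lt.1 hlt)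
        rw [this]
    · simp
    · rw [if_neg hj.asymm, if_neg hj.ne', filter_false_of_mem fun a _ => (hcol _ _ _ _ hj).not_gt]
      simp
  · refine congrArg (Fin.ofNat _) ?_
    rw [card_filter_grid w (· ≤ t)]
    refine sum_congr rfl fun j _ => ?_
    simp only [rowSummary, val_ofNat_of_le (hcard _)]
    rcases lt_trichotomy j i with hj | rfl | hj
    · rw [if_pos hj, filter_true_of_mem fun a _ => hcol _ _ _ _ hj]
      simp
    · simp
    · rw [if_neg hj.asymm, if_neg hj.ne']
      split_ifs with hle
      · have : w (toLex (j, ⟨0, hn⟩)) = t := le_antisymm hle (hcol _ _ _ _ hj)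
        rw [this]
      · rw [filter_false_of_mem fun a _ h => hle ((hfirst j a).trans h)]
        simp
  · refine congrArg (Fin.ofNat _) ?_
    have hcard' : ∀ ω : Fin n → S, #(univ.image ω) ≤ n := fun ω =>
      card_image_le.trans (by simp)
    simp only [rowSummary, val_ofNat_of_le (hcard' _)]
    -- Removing only the last values of earlier rows leaves exactly the values new in row `j`, since
    -- a repeated value must be such a last value.
    let L : Fin n → Finset S := fun j =>
      ({j' | j' < j} : Finset (Fin n)).image fun j' => w (toLex (j', ⟨n - 1, by omega⟩))
    let N : Fin n → Finset S := fun j => (univ.image fun a => w (toLex (j, a))) \ L j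
    have hmemN : ∀ j c, c ∈ N j ↔ (∃ a, w (toLex (j, a)) = c) ∧
        ∀ j' < j, w (toLex (j', ⟨n - 1, by omega⟩)) ≠ c := by
      intro j c
      simp [N, L]
    have hearlier : ∀ j j' a a', j' < j → w (toLex (j', a')) = w (toLex (j, a)) →
        w (toLex (j', ⟨n - 1, by omega⟩)) = w (toLex (j, a)) := fun j j' a a' hj h =>
      le_antisymm (hcol _ _ _ _ hj) (h ▸ hlast j' a')
    have hsplit : {c ∈ univ.image w | c ≤ t} =
        univ.biUnion fun j => {c ∈ N j | c ≤ t} := by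
      ext c
      simp only [mem_filter, mem_image, mem_univ, true_and, mem_biUnion, hmemN]
      constructor
      · rintro ⟨⟨p, rfl⟩, hc⟩
        obtain ⟨j, ⟨a, ha⟩, hmin⟩ := exists_minimal_of_wellFoundedLT
          (fun j => ∃ a, w (toLex (j, a)) = w p) ⟨(ofLex p).1, (ofLex p).2, rfl⟩
        refine ⟨j, ⟨⟨a, ha⟩, fun j' hj' h => ?_⟩, hc⟩
        exact absurd (hmin ⟨_, h⟩ hj'.le) (not_le.2 hj')
      · rintro ⟨j, ⟨⟨a, rfl⟩, -⟩, hc⟩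
        exact ⟨⟨_, rfl⟩, hc⟩
    rw [hsplit, card_biUnion]
    · refine sum_congr rfl fun j _ => ?_
      have hN : (univ.image fun a => w (toLex (j, a))) \ L j =
          if ∃ j' < j, w (toLex (j', ⟨n - 1, by omega⟩)) = w (toLex (j, ⟨0, hn⟩)) then
            (univ.image fun a => w (toLex (j, a))).erase (w (toLex (j, ⟨0, hn⟩)))
          else univ.image fun a => w (toLex (j, a)) := by
        split_ifs with hex
        · obtain ⟨j', hj', he⟩ := hex
          ext c
          simp only [mem_sdiff, mem_erase, L, mem_image, mem_univ, true_and, mem_filter]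
          constructor
          · rintro ⟨h, h'⟩
            exact ⟨fun h₀ => h' ⟨j', hj', he.trans h₀.symm⟩, h⟩
          · rintro ⟨h, ⟨a, rfl⟩⟩
            refine ⟨⟨a, rfl⟩, ?_⟩
            rintro ⟨j'', hj'', he'⟩
            exact h (le_antisymm (he' ▸ hcol _ _ _ _ hj'') (hfirst j a))
        · rw [Finset.sdiff_eq_self_iff_disjoint, disjoint_left]
          intro c hc hc'
          simp only [L, mem_image, mem_univ, true_and, mem_filter] at hc hc'
          obtain ⟨a, rfl⟩ := hc
          obtain ⟨j', hj', he⟩ := hc'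
          exact hex ⟨j', hj', le_antisymm (hcol _ _ _ _ hj') (he ▸ hfirst j a)⟩
      have hmem : w (toLex (j, ⟨0, hn⟩)) ∈ univ.image fun a => w (toLex (j, a)) :=
        mem_image_of_mem (fun a => w (toLex (j, a))) (mem_univ _)
      rcases lt_trichotomy j i with hj | rfl | hj
      · rw [if_pos hj.le, if_neg hj.ne, filter_true_of_mem]
        · simp only [N]
          rw [hN]
          split_ifs with hex
          · rw [card_erase_of_mem hmem]
          · simp
        · intro c hc
          obtain ⟨⟨a, rfl⟩, -⟩ := (hmemN _ _).1 hc
          exact hcol _ _ _ _ hj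
      · rw [if_pos le_rfl, if_pos rfl]
        simp only [N]
        rw [hN]
        split_ifs with hex
        · rw [filter_erase, card_erase_of_mem]
          exact mem_filter.2 ⟨hmem, hfirst _ _⟩
        · simp
      · rw [if_neg hj.not_ge, filter_false_of_mem]
        · simp
        · intro c hc hct
          obtain ⟨⟨a, rfl⟩, hc'⟩ := (hmemN _ _).1 hc
          refine hc' i hj (hearlier _ _ _ b hj ?_)
          exact le_antisymm (hcol _ _ _ _ hj) hct
    · intro j _ j' _ hne
      wlog hlt : j < j' generalizing j j'
      · exact (this (mem_coe.2 (mem_univ _)) (mem_coe.2 (mem_univ _)) hne.symm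
          (lt_of_le_of_ne (not_lt.1 hlt) hne.symm)).symm
      rw [Function.onFun, disjoint_left]
      intro c hc hc'
      obtain ⟨⟨a, rfl⟩, -⟩ := (hmemN _ _).1 (mem_filter.1 hc).1
      obtain ⟨⟨a', ha'⟩, h⟩ := (hmemN _ _).1 (mem_filter.1 hc').1
      exact h j hlt (by rw [← ha']; exact hearlier _ _ _ a hlt ha'.symm)

end Grid

/-! ### Returning ranks to their origins, and agreeing on a best entry -/

section Entries

variable {n B : ℕ} {S : Type} [LinearOrder S]

theorem entry_comp_perm (w : Fin n ×ₗ Fin n → S) (σ : Equiv.Perm (Fin n ×ₗ Fin n)) (t : S) :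
    entry (w ∘ σ) t = entry w t := by
  have h : ∀ (q : S → Prop) [DecidablePred q], #{p | q ((w ∘ σ) p)} = #{p | q (w p)} := by
    intro q _
    simp only [card_filter, Function.comp_apply]
    exact Equiv.sum_comp σ fun p => if q (w p) then 1 else 0
  have himage : univ.image (w ∘ σ) = univ.image w := by
    rw [← image_image, image_univ_equiv]
  rw [entry, entry, h (· < t), h (· ≤ t), himage]

/-- Every node learns the ranks of its values. -/
theorem solvable_entries [Nonempty S] (hn : 0 < n)
    (hsort : Fits B (Fin 144 → Option (S × (Fin n ×ₗ Fin n))))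
    (hsum : Fits B (S × S × Fin (n * n + 1) × Fin (n * n + 1) × Fin (n * n + 1)))
    (hdel : Fits B (Fin 144 → Option ((Fin n ×ₗ Fin n) ×
      (S × Fin (n * n + 1) × Fin (n * n + 1) × Fin (n * n + 1))))) :
    Solvable 129 B (fun (x : Fin n → Fin n → S)
      (y : Fin n → Fin n → S × Fin (n * n + 1) × Fin (n * n + 1) × Fin (n * n + 1)) =>
        ∀ i a, y i a = entry (fun p => x (row p) (ofLex p).2) (x i a)) := by
  have h₁ := solvable_sort hn (T := S ×ₗ (Fin n ×ₗ Fin n)) hsort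
  -- The position tag makes all entries distinct and later serves as the return address.
  have h₀ := solvable_local 0 B fun (_ : Fin n) (s : Fin n → S) (p : Fin n ×ₗ Fin n) =>
    (toLex (s (ofLex p).2, p) : S ×ₗ (Fin n ×ₗ Fin n))
  have h₂ := solvable_broadcast hsum
    (fun j (s : Fin n ×ₗ Fin n → S ×ₗ (Fin n ×ₗ Fin n)) =>
      rowSummary hn fun a => (ofLex (s (toLex (j, a)))).1)
    (fun i s m p => ((ofLex (s p)).2,
      rowEntry i (fun a => (ofLex (s (toLex (i, a)))).1) m (ofLex (s p)).1))
  refine (((h₀.trans h₁).trans h₂).trans (solvable_deliver hn hdel)).imp ?_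
  rintro x y ⟨u, ⟨w, ⟨v, hv, hw⟩, hu⟩, hy⟩
  set key : Fin n ×ₗ Fin n → S := fun p => x (row p) (ofLex p).2 with hkey
  have hz : ∀ p, contents row v p = toLex (key p, p) := fun p => by simp only [contents, hv, hkey]
  obtain ⟨σ, hσ⟩ := exists_perm_monotone (contents row v)
  rw [classSort_const_eq hσ] at hw
  have hw' : ∀ q, w (row q) q = toLex (key (σ q), σ q) := fun q =>
    (congrFun hw q).trans (hz (σ q))
  have hmono : Monotone (key ∘ σ) := by
    intro q q' hqq'
    have := hσ hqq'
    simp only [Function.comp_apply, hz] at this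
    rcases Prod.Lex.toLex_le_toLex.1 this with h | h
    · exact h.le
    · exact h.1.le
  have hu' : ∀ q, contents row u q = (σ q, entry key (key (σ q))) := by
    intro q
    have hrow : ∀ j a, w j (toLex (j, a)) = toLex (key (σ (toLex (j, a))), σ (toLex (j, a))) :=
      fun j a => hw' (toLex (j, a))
    simp only [contents, hu, hw', hrow, ofLex_toLex]
    refine Prod.ext rfl ?_
    exact (rowEntry_eq hn hmono (row q) (ofLex q).2).trans (entry_comp_perm _ _ _)
  intro i a
  have := hy σ (fun q => by rw [hu']) (σ.symm (toLex (i, a)))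
  simp only [hu', Equiv.apply_symm_apply] at this
  exact this

/-- All nodes agree on an entry that is best among those in the system that are `good`. -/
theorem solvable_announce {E : Type} (hE : Fits B (Option E)) (good : E → Prop) (wt : E → ℕ) :
    Solvable 1 B (fun (y : Fin n → Fin n → E) (out : Fin n → Option E) =>
      ∃ r, (∀ i, out i = r) ∧ ((r = none ∧ ∀ j a, ¬ good (y j a)) ∨
        ∃ j a, r = some (y j a) ∧ good (y j a) ∧
          ∀ j' a', good (y j' a') → wt (y j' a') ≤ wt (y j a))) := by
  classical
  -- The same selection rule serves twice: each node picks from its own entries, then all nodes pick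
  -- identically from the broadcast candidates.
  have hpick : ∀ f : Fin n → Option E, ∃ r : Option E,
      (r = none ∧ ∀ j e, f j = some e → ¬ good e) ∨
      ∃ j e, f j = some e ∧ r = some e ∧ good e ∧
        ∀ j' e', f j' = some e' → good e' → wt e' ≤ wt e := by
    intro f
    rcases (univ.filter fun j => ∃ e, f j = some e ∧ good e).eq_empty_or_nonempty with h | h
    · refine ⟨none, .inl ⟨rfl, fun j e hj he => ?_⟩⟩
      have : j ∈ univ.filter fun j => ∃ e, f j = some e ∧ good e := by
        simpa using ⟨e, hj, he⟩
      rw [h] at this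
      simp at this
    · obtain ⟨j, hj, hmax⟩ := exists_max_image _ (fun j => ((f j).map wt).getD 0) h
      simp only [mem_filter, mem_univ, true_and] at hj hmax
      obtain ⟨e, hje, he⟩ := hj
      refine ⟨some e, .inr ⟨j, e, hje, rfl, he, fun j' e' hj' he' => ?_⟩⟩
      simpa [hje, hj'] using hmax j' ⟨e', hj', he'⟩
  choose best hbest using hpick
  refine (solvable_broadcast hE (fun _ (y : Fin n → E) => best fun a => some (y a))
    (fun _ _ m => best m)).imp ?_
  intro y out hout
  refine ⟨_, hout, ?_⟩
  have hloc : ∀ j, _ := fun j => hbest fun a => some (y j a)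
  rcases hbest (fun j => best fun a => some (y j a)) with ⟨hr, hnone⟩ | ⟨j, e, hj, hr, he, hmax⟩
  · refine .inl ⟨hr, fun j a hja => ?_⟩
    rcases hloc j with ⟨-, h⟩ | ⟨a', e, -, he, hgood, -⟩
    · exact h a _ rfl hja
    · exact hnone j e he hgood
  · rcases hloc j with ⟨h, -⟩ | ⟨a, e', ha, he', hgood, -⟩
    · rw [h] at hj
      cases hj
    · obtain rfl : e' = e := Option.some.inj (he'.symm.trans hj)
      obtain rfl := Option.some.inj ha
      refine .inr ⟨j, a, hr, hgood, fun j' a' hg => ?_⟩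
      rcases hloc j' with ⟨-, h⟩ | ⟨a'', e'', -, h', hg', hmax'⟩
      · exact absurd hg (h a' _ rfl)
      · exact (hmax' a' _ rfl hg).trans (hmax j' e'' h' hg')

end Entries

/-! ### The sorted sequences of keys -/

section Keys

variable {n : ℕ} {K : Type}

/-- The key at position `(i, a)`, or `⊤` if the list of node `i` is too short. -/
def keyAt (x : Fin n → KeyInput n K) (p : Fin n ×ₗ Fin n) : WithTop K :=
  (x (row p)).1[(ofLex p).2.1]?

theorem _root_.List.countP_eq_card_filter_fin {α : Type} (l : List α) (hl : l.length ≤ n)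
    (q : α → Prop) [DecidablePred q] :
    l.countP (fun b => q b) = #{a : Fin n | ∃ b, l[a.1]? = some b ∧ q b} := by
  classical
  have key : ∀ n, l.length ≤ n →
      l.countP (fun b => q b) = ∑ a ∈ range n, if ∃ b, l[a]? = some b ∧ q b then 1 else 0 := by
    clear hl
    induction l with
    | nil => simp
    | cons c l ih =>
      intro n hn
      obtain _ | n := n
      · simp at hn
      rw [sum_range_succ', List.countP_cons, ih n (by simpa using hn)]
      simp
  rw [key n hl, card_filter, sum_range]

open Classical in
theorem countP_allKeys (x : Fin n → KeyInput n K) (q : K → Prop) [DecidablePred q] :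
    (allKeys x).countP q = #{p | ∃ b : K, keyAt x p = b ∧ q b} := by
  rw [card_filter_grid (keyAt x) (fun t => ∃ b : K, t = b ∧ q b), allKeys,
    ← Multiset.coe_countPAddMonoidHom, map_sum]
  refine sum_congr rfl fun i _ => ?_
  rw [Multiset.coe_countPAddMonoidHom, Multiset.coe_countP,
    List.countP_eq_card_filter_fin _ (x i).2]
  congr 1
  ext a
  simp only [mem_filter, mem_univ, true_and]
  rfl

theorem mem_allKeys_iff (x : Fin n → KeyInput n K) (b : K) :
    b ∈ allKeys x ↔ ∃ p, keyAt x p = b := by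
  classical
  have := countP_allKeys x (fun c => c = b)
  rw [← Multiset.count_pos, Multiset.count]
  simp only [eq_comm (a := b)]
  rw [this, card_pos]
  simp [Finset.Nonempty]

variable [LinearOrder K]

/-- In a sorted list the copies of `a` fill the block between the number of smaller elements and the
number of elements up to `a`. -/
theorem _root_.List.Pairwise.getElem?_eq_some_iff {l : List K} (hl : l.Pairwise (· ≤ ·)) (a : K)
    (k : ℕ) : l[k]? = some a ↔ l.countP (· < a) ≤ k ∧ k < l.countP (· ≤ a) := by
  have hlt : ∀ hk : k < l.length, l[k] < a ↔ k < l.countP (· < a) := fun hk => by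
    have := hl.getElem_iff_lt_countP (fun b => b < a)
      (fun b c hbc hc => by simp at hc ⊢; exact hbc.trans_lt hc) k hk
    simpa using this
  have hle : ∀ hk : k < l.length, l[k] ≤ a ↔ k < l.countP (· ≤ a) := fun hk => by
    have := hl.getElem_iff_lt_countP (fun b => b ≤ a)
      (fun b c hbc hc => by simp at hc ⊢; exact hbc.trans hc) k hk
    simpa using this
  rw [List.getElem?_eq_some_iff]
  constructor
  · rintro ⟨hk, rfl⟩
    exact ⟨not_lt.1 fun h => lt_irrefl _ ((hlt hk).2 h), (hle hk).1 le_rfl⟩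
  · rintro ⟨h, h'⟩
    have hk : k < l.length := h'.trans_le List.countP_le_length
    exact ⟨hk, le_antisymm ((hle hk).2 h') (not_lt.1 fun hc => absurd ((hlt hk).1 hc) h.not_gt)⟩

theorem _root_.List.Nodup.countP_le_eq_countP_lt_add_one {l : List K} (hl : l.Nodup) {a : K}
    (ha : a ∈ l) : l.countP (· ≤ a) = l.countP (· < a) + 1 := by
  have h : l.count a = 1 := List.count_eq_one_of_mem hl ha
  rw [← h]
  clear h ha hl
  induction l with
  | nil => simp
  | cons b l ih =>
    simp only [List.countP_cons, List.count_cons, ih]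
    rcases lt_trichotomy b a with hb | rfl | hb
    · simp [hb, hb.le, hb.ne]; omega
    · simp; omega
    · simp [hb.not_ge, hb.not_gt, hb.ne']

theorem val_ofNat_of_le_sq {v : ℕ} (hv : v ≤ n * n) : (Fin.ofNat (n * n + 1) v).1 = v := by
  rw [Fin.val_ofNat, Nat.mod_eq_of_lt]
  omega

theorem card_grid : Fintype.card (Fin n ×ₗ Fin n) = n * n := by
  rw [← Fintype.card_congr (toLex : Fin n × Fin n ≃ _)]
  simp

/-- The padding ⊤ is never below a genuine key, so ranks in the padded array are ranks among the
keys. They are at most n², so reduction mod n² + 1 does not alter them. -/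
theorem entry_keyAt_lt (x : Fin n → KeyInput n K) (b : K) :
    (entry (keyAt x) b).2.1.1 = (allKeys x).countP (· < b) := by
  have h : #{p | keyAt x p < b} = (allKeys x).countP (· < b) := by
    rw [countP_allKeys]
    congr 1
    ext p
    simp only [mem_filter, mem_univ, true_and]
    exact WithTop.lt_iff_exists_coe.trans (by simp)
  rw [← h]
  exact val_ofNat_of_le_sq ((card_le_univ _).trans card_grid.le)

theorem entry_keyAt_le (x : Fin n → KeyInput n K) (b : K) :
    (entry (keyAt x) b).2.2.1.1 = (allKeys x).countP (· ≤ b) := by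
  have h : #{p | keyAt x p ≤ b} = (allKeys x).countP (· ≤ b) := by
    rw [countP_allKeys]
    congr 1
    ext p
    simp only [mem_filter, mem_univ, true_and]
    exact WithTop.le_coe_iff
  rw [← h]
  exact val_ofNat_of_le_sq ((card_le_univ _).trans card_grid.le)

theorem entry_keyAt_distinct (x : Fin n → KeyInput n K) (b : K) :
    (entry (keyAt x) b).2.2.2.1 = (sortedDistinctKeys x).countP (· ≤ b) := by
  classical
  have h : #{t ∈ univ.image (keyAt x) | t ≤ (b : WithTop K)} = (sortedDistinctKeys x).countP (· ≤ b) := by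
    rw [← Multiset.coe_countP, sortedDistinctKeys, Finset.sort_eq, Multiset.countP_eq_card_filter,
      ← Finset.filter_val, ← Finset.card_def]
    symm
    refine card_bij (fun c _ => (c : WithTop K)) ?_ ?_ ?_
    · intro c hc
      simp only [mem_filter, Multiset.mem_toFinset, mem_allKeys_iff] at hc
      simpa using hc
    · intro c _ c' _ h
      exact WithTop.coe_injective h
    · intro t ht
      simp only [mem_filter, mem_image, mem_univ, true_and] at ht
      obtain ⟨c, rfl, hc⟩ := WithTop.le_coe_iff.1 ht.2
      refine ⟨c, ?_, rfl⟩
      simp only [mem_filter, Multiset.mem_toFinset, mem_allKeys_iff]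
      exact ⟨ht.1, hc⟩
  rw [← h]
  exact val_ofNat_of_le_sq ((card_filter_le _ _).trans
    (card_image_le.trans ((card_le_univ _).trans card_grid.le)))

theorem sortedKeys_getElem?_iff (x : Fin n → KeyInput n K) (k : ℕ) (b : K) :
    (sortedKeys x)[k]? = some b ↔
      (entry (keyAt x) b).2.1.1 ≤ k ∧ k < (entry (keyAt x) b).2.2.1.1 := by
  have hs : (sortedKeys x).Pairwise (· ≤ ·) := Multiset.pairwise_sort _ _
  rw [hs.getElem?_eq_some_iff, entry_keyAt_lt,
    entry_keyAt_le, ← Multiset.coe_countP, ← Multiset.coe_countP, sortedKeys, Multiset.sort_eq]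

/-- A present key occurs once in the distinct sequence, so its count up to `b` is its zero-based
position plus one. For an absent `b` the count alone would not suffice. -/
theorem sortedDistinctKeys_getElem?_iff (x : Fin n → KeyInput n K) (k : ℕ) (b : K)
    (hb : b ∈ allKeys x) :
    (sortedDistinctKeys x)[k]? = some b ↔ (entry (keyAt x) b).2.2.2.1 = k + 1 := by
  have hmem : b ∈ sortedDistinctKeys x := by simpa [sortedDistinctKeys] using hb
  have hs : (sortedDistinctKeys x).Pairwise (· ≤ ·) := Finset.pairwise_sort _ _
  have hnodup : (sortedDistinctKeys x).Nodup := Finset.sort_nodup _ _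
  rw [hs.getElem?_eq_some_iff, entry_keyAt_distinct, hnodup.countP_le_eq_countP_lt_add_one hmem]
  omega

theorem idxOf_sortedDistinctKeys (x : Fin n → KeyInput n K) (b : K) (hb : b ∈ allKeys x) :
    (sortedDistinctKeys x).idxOf b + 1 = (entry (keyAt x) b).2.2.2.1 := by
  have hmem : b ∈ sortedDistinctKeys x := by simpa [sortedDistinctKeys] using hb
  exact ((sortedDistinctKeys_getElem?_iff x _ b hb).1 (List.getElem?_idxOf hmem)).symm

theorem entry_keyAt_sub (x : Fin n → KeyInput n K) (b : K) :
    (entry (keyAt x) b).2.2.1.1 - (entry (keyAt x) b).2.1.1 = (allKeys x).count b := by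
  classical
  rw [entry_keyAt_lt, entry_keyAt_le]
  have : (allKeys x).countP (· ≤ b) = (allKeys x).countP (· < b) + (allKeys x).count b := by
    induction allKeys x using Multiset.induction_on with
    | empty => simp
    | cons a s ih =>
      simp only [Multiset.countP_cons, Multiset.count_cons, ih]
      rcases lt_trichotomy a b with h | rfl | h
      · simp [h, h.le, h.ne']; omega
      · simp; omega
      · simp [h.not_ge, h.not_gt, h.ne]
  omega

end Keys

/-! ### The tasks -/

section SolveTasks

variable {n B : ℕ} {K : Type}

/-- What a node learns about a key: the key (or `⊤` in place of a missing key) and its ranks. -/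
abbrev KeyEntry (n : ℕ) (K : Type) : Type :=
  WithTop K × Fin (n * n + 1) × Fin (n * n + 1) × Fin (n * n + 1)

/-- The messages that the algorithms use fit into `B` bits. -/
structure Capacity (n B : ℕ) (K : Type) : Prop where
  sort : Fits B (Fin 144 → Option (WithTop K × (Fin n ×ₗ Fin n)))
  summary : Fits B (WithTop K × WithTop K × Fin (n * n + 1) × Fin (n * n + 1) × Fin (n * n + 1))
  deliver : Fits B (Fin 144 → Option ((Fin n ×ₗ Fin n) × KeyEntry n K))
  announce : Fits B (Option (KeyEntry n K))

theorem capacity_of_fits {c : ℕ} (hn : 0 < n) (hK : Fits (c * Nat.size n) K) :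
    Capacity n (144 * (c + 10) * Nat.size n) K := by
  have hℓ : 1 ≤ Nat.size n := Nat.size_pos.2 hn
  have hlt : n < 2 ^ Nat.size n := Nat.lt_size_self n
  have hS : Fits (c * Nat.size n + 1) (WithTop K) := hK.option
  have hfin : Fits (Nat.size n) (Fin n) := fits_fin hlt.le
  have hP : Fits (Nat.size n + Nat.size n) (Fin n ×ₗ Fin n) :=
    (hfin.prod hfin).of_injective ofLex ofLex.injective
  have hI : Fits (2 * Nat.size n) (Fin (n * n + 1)) := fits_fin (by
    rw [two_mul, pow_add]
    nlinarith)
  have hE := hS.prod (hI.prod (hI.prod hI))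
  -- With ℓ = `Nat.size n`, a delivery slot takes 2ℓ bits for the address, cℓ + 1 for the key, 6ℓ
  -- for three ranks and 1 for `Option`: at most (c + 10)ℓ, because ℓ ≥ 1.
  refine ⟨((hS.prod hP).option.pi 144).mono ?_, (hS.prod (hS.prod (hI.prod (hI.prod hI)))).mono ?_,
    ((hP.prod hE).option.pi 144).mono ?_, hE.option.mono ?_⟩ <;> nlinarith

/-- The key as an optional value. -/
def toOption (t : WithTop K) : Option K := t

variable [LinearOrder K]

theorem solvable_keyEntries (hn : 0 < n) (hB : Capacity n B K) :
    Solvable 129 B (fun (x : Fin n → KeyInput n K) (y : Fin n → Fin n → KeyEntry n K) =>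
      ∀ i a, y i a = entry (keyAt x) (keyAt x (toLex (i, a)))) := by
  refine ((solvable_local (β := Fin n → WithTop K) 0 B fun _ (l : KeyInput n K) a =>
    l.1[a.1]?).trans
      (solvable_entries hn hB.sort hB.summary hB.deliver)).imp ?_
  rintro x y ⟨z, hz, hy⟩ i a
  rw [hy]
  simp only [hz]
  rfl

theorem _root_.List.filterMap_finRange_getElem? {α : Type} (l : List α) (hl : l.length ≤ n) :
    (List.finRange n).filterMap (fun a => l[a.1]?) = l := by
  induction n generalizing l with
  | zero => simp_all
  | succ n ih =>
    rw [List.finRange_succ, List.filterMap_cons, List.filterMap_map]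
    cases l with
    | nil => simp
    | cons c l => simpa [Function.comp_def] using ih l (by simpa using hl)

theorem solvable_index (hn : 0 < n) (hB : Capacity n B K) :
    Solvable 130 B (IndexTask (n := n) (K := K)) := by
  refine ((solvable_keyEntries hn hB).trans
    -- One idle round brings the total to the 130 rounds used by the other tasks.
    (solvable_local 1 B fun (_ : Fin n) (y : Fin n → KeyEntry n K) =>
      (List.finRange n).filterMap fun a =>
        (toOption (y a).1).map fun _ => (y a).2.2.2.1)).imp ?_
  rintro x out ⟨y, hy, hout⟩ i
  rw [hout]
  conv_rhs => rw [← List.filterMap_finRange_getElem? (x i).1 (x i).2, List.map_filterMap]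
  refine List.filterMap_congr fun a _ => ?_
  rw [hy]
  change Option.map _ (toOption (keyAt x (toLex (i, a)))) =
    Option.map _ (toOption (keyAt x (toLex (i, a))))
  rcases hkey : keyAt x (toLex (i, a)) with _ | b
  · rfl
  · exact congrArg some (idxOf_sortedDistinctKeys x b ((mem_allKeys_iff x b).2 ⟨_, hkey⟩)).symm

/-- All nodes agree on a key whose entry is best among the `good` ones. -/
theorem solvable_bestKey (hn : 0 < n) (hB : Capacity n B K) (good : KeyEntry n K → Prop)
    (wt : KeyEntry n K → ℕ) :
    Solvable 130 B (fun (x : Fin n → KeyInput n K) (out : Fin n → Option K) =>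
      ∃ r, (∀ i, out i = r) ∧
        ((r = none ∧ ∀ b ∈ allKeys x, ¬ good (entry (keyAt x) b)) ∨
          ∃ b ∈ allKeys x, r = some b ∧ good (entry (keyAt x) b) ∧
            ∀ b' ∈ allKeys x, good (entry (keyAt x) b') →
              wt (entry (keyAt x) b') ≤ wt (entry (keyAt x) b))) := by
  refine (((solvable_keyEntries hn hB).trans
    -- Excluding ⊤ keeps the padding from being chosen.
    (solvable_announce hB.announce (fun e => e.1 ≠ ⊤ ∧ good e) wt)).trans
      (solvable_local 0 B fun (_ : Fin n) (r : Option (KeyEntry n K)) =>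
        r.bind fun e => toOption e.1)).imp ?_
  rintro x out ⟨v, ⟨y, hy, r, hr, hbest⟩, hout⟩
  refine ⟨r.bind fun e => toOption e.1, fun i => by rw [hout, hr], ?_⟩
  rcases hbest with ⟨rfl, hnone⟩ | ⟨j, a, rfl, ⟨htop, hgood⟩, hmax⟩
  · refine .inl ⟨rfl, fun b hb hgood => ?_⟩
    obtain ⟨p, hp⟩ := (mem_allKeys_iff x b).1 hb
    refine hnone (row p) (ofLex p).2 ?_
    have : y (row p) (ofLex p).2 = entry (keyAt x) b := by rw [← hp]; exact hy _ _
    rw [this]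
    exact ⟨WithTop.coe_ne_top, hgood⟩
  · rw [hy] at htop hgood hmax
    obtain ⟨b, hb⟩ := WithTop.ne_top_iff_exists.1 htop
    replace hb : keyAt x (toLex (j, a)) = b := hb.symm
    rw [hb] at hgood hmax
    refine .inr ⟨b, (mem_allKeys_iff x b).2 ⟨_, hb⟩, ?_, hgood, fun b' hb' hgood' => ?_⟩
    · rw [hy, hb]
      rfl
    · obtain ⟨p, hp⟩ := (mem_allKeys_iff x b').1 hb'
      have := hmax (row p) (ofLex p).2
      have he : y (row p) (ofLex p).2 = entry (keyAt x) b' := by rw [← hp]; exact hy _ _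
      rw [he] at this
      exact this ⟨WithTop.coe_ne_top, hgood'⟩

theorem solvable_selection (hn : 0 < n) (hB : Capacity n B K) (k : ℕ) :
    Solvable 130 B (SelectionTask (n := n) (K := K) k) := by
  -- The weight is constant because at most one key occupies position `k`.
  refine (solvable_bestKey hn hB (fun e => e.2.1.1 ≤ k ∧ k < e.2.2.1.1) 0).imp ?_
  rintro x out ⟨r, hr, h⟩ i
  rw [hr]
  rcases h with ⟨rfl, hnone⟩ | ⟨b, -, rfl, hgood, -⟩
  · symm
    rw [Option.eq_none_iff_forall_ne_some]
    intro b hb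
    have hmem : b ∈ allKeys x := by simpa [sortedKeys] using List.mem_of_getElem? hb
    exact hnone b hmem ((sortedKeys_getElem?_iff x k b).1 hb)
  · exact ((sortedKeys_getElem?_iff x k b).2 hgood).symm

theorem solvable_distinctSelection (hn : 0 < n) (hB : Capacity n B K) (k : ℕ) :
    Solvable 130 B (DistinctSelectionTask (n := n) (K := K) k) := by
  refine (solvable_bestKey hn hB (fun e => e.2.2.2.1 = k + 1) 0).imp ?_
  rintro x out ⟨r, hr, h⟩ i
  rw [hr]
  rcases h with ⟨rfl, hnone⟩ | ⟨b, hb, rfl, hgood, -⟩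
  · symm
    rw [Option.eq_none_iff_forall_ne_some]
    intro b hb
    have hmem : b ∈ allKeys x := by simpa [sortedDistinctKeys] using List.mem_of_getElem? hb
    exact hnone b hmem ((sortedDistinctKeys_getElem?_iff x k b hmem).1 hb)
  · exact ((sortedDistinctKeys_getElem?_iff x k b hb).2 hgood).symm

theorem solvable_mode (hn : 0 < n) (hB : Capacity n B K) :
    Solvable 130 B (ModeTask (n := n) (K := K)) := by
  -- The difference of the two ranks is the multiplicity of the key.
  refine (solvable_bestKey hn hB (fun _ => True) (fun e => e.2.2.1.1 - e.2.1.1)).imp ?_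
  rintro x out ⟨r, hr, h⟩
  simp only [entry_keyAt_sub] at h
  rcases h with ⟨rfl, hnone⟩ | ⟨b, hb, rfl, -, hmax⟩
  · refine ⟨fun _ => hr, fun hne => ?_⟩
    obtain ⟨b, hb⟩ := Multiset.exists_mem_of_ne_zero hne
    exact absurd trivial (hnone b hb)
  · refine ⟨fun h0 => ?_, fun _ => ⟨b, ⟨hb, fun b' => ?_⟩, hr⟩⟩
    · rw [h0] at hb
      simp at hb
    · by_cases hb' : b' ∈ allKeys x
      · exact hmax b' hb' trivial
      · rw [Multiset.count_eq_zero_of_notMem hb']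
        exact Nat.zero_le _

end SolveTasks

end CongestedClique

/-- Keys come from any totally ordered set whose elements are encoded by bit strings of length
`c * Nat.size n`, where `Nat.size n` is the number of binary digits of `n`. The number `R` of rounds
is an absolute constant, and messages have `C * Nat.size n` bits with `C` depending only on `c`. -/
theorem corollary4p5 :
    ∃ R : ℕ, ∀ c : ℕ, ∃ C : ℕ, ∀ (n : ℕ) (K : Type) [LinearOrder K]
      (_encode : K ↪ CongestedClique.Message (c * Nat.size n)),
      CongestedClique.Solvable R (C * Nat.size n)
        (CongestedClique.IndexTask (n := n) (K := K)) ∧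
      (∀ k : ℕ, CongestedClique.Solvable R (C * Nat.size n)
        (CongestedClique.SelectionTask (n := n) (K := K) k)) ∧
      (∀ k : ℕ, CongestedClique.Solvable R (C * Nat.size n)
        (CongestedClique.DistinctSelectionTask (n := n) (K := K) k)) ∧
      CongestedClique.Solvable R (C * Nat.size n)
        (CongestedClique.ModeTask (n := n) (K := K)) := by
  refine ⟨130, fun c => ⟨144 * (c + 10), fun n K _ encode => ?_⟩⟩
  -- Without nodes all conditions on outputs are vacuous, and the mode task only needs that the
  -- multiset of keys is empty.
  obtain rfl | hn := n.eq_zero_or_pos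
  · have hlocal : ∀ Out : Type, CongestedClique.Solvable 130 (144 * (c + 10) * Nat.size 0)
        (fun (_ : Fin 0 → CongestedClique.KeyInput 0 K) (_ : Fin 0 → Out) => True) := fun Out =>
      (CongestedClique.solvable_local 130 _ fun i => i.elim0).imp fun _ _ _ => trivial
    refine ⟨(hlocal _).imp fun x y _ i => i.elim0, fun k => (hlocal _).imp fun x y _ i => i.elim0,
      fun k => (hlocal _).imp fun x y _ i => i.elim0, (hlocal _).imp fun x y _ => ?_⟩
    exact ⟨fun _ i => i.elim0, fun h => absurd (by simp [CongestedClique.allKeys]) h⟩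
  · have hB := CongestedClique.capacity_of_fits hn ⟨encode⟩
    exact ⟨CongestedClique.solvable_index hn hB, CongestedClique.solvable_selection hn hB,
      CongestedClique.solvable_distinctSelection hn hB, CongestedClique.solvable_mode hn hB⟩
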